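/- **Setting.** Let $[n]=\{1,\dots,n\}$ be a set of actions, let $f:2^{[n]}\to[0,1]$ be a monotone reward function and $c:2^{[n]}\to\mathbb{R}_{\ge 0}$ a monotone cost function. A set function $v$ is *supermodular* if $v(S\cup\{i\})-v(S)\le v(T\cup\{i\})-v(T)$ for all $S\subseteq T\subseteq[n]$ and $i\in[n]\setminus T$. Given a contract $\alpha\in[0,1]$, a *best response* is a set $S_\alpha$ that maximizes $\alpha f(S)-c(S)$, where ties are broken in favour of a larger value of $f$. An *optimal contract* is an $\alpha^\star\in[0,1]$ that maximizes the principal's utility $(1-\alpha)f(S_\alpha)$ over $\alpha\in[0,1]$. **Protocols.** Alice holds $f$ and Bob holds $c$. They share random bits and exchange bits according to a protocol: the transcript so far determines who acts next, and the bit sent depends on the sender's own input, the transcript, the shared randomness and the answers to the sender's own earlier oracle queries. At any time each party may privately query a best-response oracle, which on a contract $\alpha\in[0,1]$ returns a best response $S_\alpha$ for the instance $\langle n,f,c\rangle$ (any fixed rule may be used if several sets are best responses). At the end one of the parties announces a contract. The protocol *computes the optimal contract* on a class of instances if on every instance of the class the announced contract is optimal with probability at least $2/3$. Its communication is the number of bits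 exchanged on the worst instance of the class. **Instances.** So that the inputs are finite objects, for $b\in\mathbb{N}$ let $\mathcal{I}_{n,b}$ be the set of all instances $\langle n,f,c\rangle$ such that $f$ and $c$ are both monotone and supermodular and all their values are of the form $k/2^b$ with $k\in\{0,1,\dots,2^b\}$. **Theorem.** There are a polynomial $b$ and a constant $C>0$ such that for every polynomial $q$ there is an $N$ such that for all $n\ge N$ the following holds. Every randomized protocol that computes the optimal contract on $\mathcal{I}_{n,b(n)}$ and makes at most $q(n)$ best-response queries on each instance of $\mathcal{I}_{n,b(n)}$ exchanges, in the worst case, at least $C\cdot 2^n/\sqrt{n}$ bits. Hence, when $f$ and $c$ are both supermodular, any protocol that computes the optimal contract and makes $\mathrm{poly}(n)$ best-response queries requires $\Omega(2^n/\sqrt{n})$ bits of communication, even if all values of $f$ and $c$ are represented with $\mathrm{poly}(n)$ bits. -/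

import Mathlib

open MeasureTheory

/-- A real-valued set function on the action set `[n]`. -/
abbrev SetFn (n : ℕ) : Type := Finset (Fin n) → ℝ

/-- The marginal value `v(i ∣ S) = v(S ∪ {i}) - v(S)`. -/
def marginal {n : ℕ} (v : SetFn n) (i : Fin n) (S : Finset (Fin n)) : ℝ :=
  v (insert i S) - v S

/-- Decreasing marginal values. -/
def IsSubmodular {n : ℕ} (v : SetFn n) : Prop :=
  ∀ S T : Finset (Fin n), S ⊆ T → ∀ i, i ∉ T → marginal v i T ≤ marginal v i S

/-- Increasing marginal values. -/
def IsSupermodular {n : ℕ} (v : SetFn n) : Prop :=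
  IsSubmodular (fun S => -v S)

/-- The agent's utility from the set `S` of actions under the contract `α`. -/
def agentUtility {n : ℕ} (f c : SetFn n) (α : unitInterval) (S : Finset (Fin n)) : ℝ :=
  (α : ℝ) * f S - c S

/-- The principal's utility from the set `S` of actions under the contract `α`. -/
def principalUtility {n : ℕ} (f : SetFn n) (α : unitInterval) (S : Finset (Fin n)) : ℝ :=
  (1 - (α : ℝ)) * f S

/-- `S` maximizes the agent's utility under `α`; ties are broken in favour of the principal, that
is, towards higher values of `f`. -/
def IsBestResponse {n : ℕ} (f c : SetFn n) (α : unitInterval) (S : Finset (Fin n)) : Prop :=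
  (∀ T, agentUtility f c α T ≤ agentUtility f c α S) ∧
    ∀ T, agentUtility f c α T = agentUtility f c α S → f T ≤ f S

/-- `α` maximizes the principal's utility over all contracts in `[0,1]`, the agent always playing
a best response. -/
def IsOptimalContract {n : ℕ} (f c : SetFn n) (α : unitInterval) : Prop :=
  ∃ S, IsBestResponse f c α S ∧
    ∀ (β : unitInterval) (T : Finset (Fin n)), IsBestResponse f c β T →
      principalUtility f β T ≤ principalUtility f α S

/-- All values of `v` are numbers in `[0,1]` with `b` binary digits after the point. -/
def HasPrecision {n : ℕ} (v : SetFn n) (b : ℕ) : Prop :=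
  ∀ S, ∃ k : ℕ, k ≤ 2 ^ b ∧ v S = (k : ℝ) / 2 ^ b

/-- The set functions that a party may receive: monotone, supermodular, with values in `[0,1]`
written with `b` binary digits. -/
structure IsAdmissible {n : ℕ} (b : ℕ) (v : SetFn n) : Prop where
  monotone : Monotone v
  supermodular : IsSupermodular v
  precision : HasPrecision v b

/-- A rule that answers best-response queries: a choice of one answer for each instance and each
contract. -/
abbrev Oracle (n : ℕ) : Type := SetFn n → SetFn n → unitInterval → Finset (Fin n)

/-- Every answer of the oracle is a best response. -/
def Oracle.Valid {n : ℕ} (br : Oracle n) : Prop :=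
  ∀ (f c : SetFn n) (α : unitInterval), IsBestResponse f c α (br f c α)

/-- A local computation of one party: adaptively ask best-response queries, then return a value. -/
inductive QueryProg (n : ℕ) (β : Type) : Type
  | ret (b : β) : QueryProg n β
  | ask (α : unitInterval) (next : Finset (Fin n) → QueryProg n β) : QueryProg n β

/-- The value returned by a local computation, together with the list of the answers received. -/
def QueryProg.run {n : ℕ} {β : Type} (O : unitInterval → Finset (Fin n)) :
    QueryProg n β → β × List (Finset (Fin n))
  | .ret b => (b, [])
  | .ask α next => (((next (O α)).run O).1, O α :: ((next (O α)).run O).2)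

/-- What one party does with its own set function and the answers to its earlier queries: it may
ask further queries, and then produces a value in `β`. -/
abbrev PartyAction (n : ℕ) (β : Type) : Type :=
  SetFn n → List (Finset (Fin n)) → QueryProg n β

/-- A deterministic two-party protocol with private best-response queries. The position in the tree
is the transcript: it determines who acts next, and whether that party sends one bit to the other
one or ends the protocol and announces a contract. -/
inductive Protocol (n : ℕ) : Type
  | aliceOutput (act : PartyAction n unitInterval) : Protocol n
  | bobOutput (act : PartyAction n unitInterval) : Protocol n
  | aliceSend (act : PartyAction n Bool) (next : Bool → Protocol n) : Protocol n
  | bobSend (act : PartyAction n Bool) (next : Bool → Protocol n) : Protocol n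

/-- The result of an execution: the contract that is output, the number of bits exchanged, and the
total number of best-response queries asked by the two parties. -/
structure Outcome where
  contract : unitInterval
  bits : ℕ
  queries : ℕ

/-- Executes a protocol. Alice sees only `f` and her own list `la` of query answers so far, Bob sees
only `c` and his own list `lb`. -/
def Protocol.run {n : ℕ} (br : Oracle n) (f c : SetFn n) :
    Protocol n → List (Finset (Fin n)) → List (Finset (Fin n)) → Outcome
  | .aliceOutput act, la, lb =>
      let r := (act f la).run (br f c)
      { contract := r.1, bits := 0, queries := (la ++ r.2).length + lb.length }
  | .bobOutput act, la, lb =>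
      let r := (act c lb).run (br f c)
      { contract := r.1, bits := 0, queries := la.length + (lb ++ r.2).length }
  | .aliceSend act next, la, lb =>
      let r := (act f la).run (br f c)
      let o := (next r.1).run br f c (la ++ r.2) lb
      { o with bits := o.bits + 1 }
  | .bobSend act next, la, lb =>
      let r := (act c lb).run (br f c)
      let o := (next r.1).run br f c la (lb ++ r.2)
      { o with bits := o.bits + 1 }

/-- The execution of a protocol from the beginning on the instance `⟨n, f, c⟩`. -/
def Protocol.exec {n : ℕ} (P : Protocol n) (br : Oracle n) (f c : SetFn n) : Outcome :=
  P.run br f c [] []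

/-- The public-coin protocol `P` (a deterministic protocol for each value `ω` of the shared
randomness) computes the optimal contract with error at most `1/3` on every admissible instance. -/
def ComputesOptimalContract {n : ℕ} (b : ℕ) (br : Oracle n) {Ω : Type*} [MeasurableSpace Ω]
    (μ : Measure Ω) (P : Ω → Protocol n) : Prop :=
  ∀ f c : SetFn n, IsAdmissible b f → IsAdmissible b c →
    μ {ω | ¬ IsOptimalContract f c ((P ω).exec br f c).contract} ≤ 1 / 3

/-- On every admissible instance, at most `q` best-response queries are asked. -/
def QueriesAtMost {n : ℕ} (b : ℕ) (br : Oracle n) {Ω : Type*} [MeasurableSpace Ω]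
    (μ : Measure Ω) (P : Ω → Protocol n) (q : ℕ) : Prop :=
  ∀ f c : SetFn n, IsAdmissible b f → IsAdmissible b c →
    ∀ᵐ ω ∂μ, ((P ω).exec br f c).queries ≤ q

/-- On every admissible instance, at most `B` bits are exchanged. -/
def BitsAtMost {n : ℕ} (b : ℕ) (br : Oracle n) {Ω : Type*} [MeasurableSpace Ω]
    (μ : Measure Ω) (P : Ω → Protocol n) (B : ℕ) : Prop :=
  ∀ f c : SetFn n, IsAdmissible b f → IsAdmissible b c →
    ∀ᵐ ω ∂μ, ((P ω).exec br f c).bits ≤ B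

/-! Put t = 1 - α. The agent's utility from S is (f S - c S) - t * f S, so every set is a line in t,
the best responses trace the upper envelope, and the principal earns t * f S, which for fixed S is
largest at the right end of its segment. In `Curve`, about binom(n, n/2) sets of size n/2 receive
lines in convex position whose right ends all yield nearly the same value U. Every second set
carries one bit of each party: Alice's bit raises its reward, Bob's bit lowers its cost. A set that
does not hold both bits yields at most U + 4F/W, a set with both bits yields more
(`tau_mul_reward_le`, `peak_mul_reward_gt`). So if the two bit strings meet in exactly one
coordinate, the optimal contract names it (`eq_peak_of_isOptimalContract`). All of this is a
perturbation of h * |S|^2 by at most h/2, which preserves monotonicity and supermodularity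
(`isAdmissible_of_perturbation`).

Oracle answers depend on both inputs and could leak information. But whether S is a best response
depends only on the bits of the two parties at the rank of S and the two adjacent ranks
(`isBestResponse_congr`). When these six bits are attached to each answer, the inputs with a given
record form a rectangle (`Protocol.record_eq_of_record_eq`), and the logarithm of the number of
records is O(B + nq + n).

It remains to show that naming the common element of two sets that meet once needs 2^Ω(K) rectangles
(`card_le_log_of_label`). A random direction D splits the coordinates between the parties,
coordinate i is set to the same value on both sides, and the values true and false are compared.
With false the pair is disjoint, so on average over i the label is i with probability O(1/K). A
rectangle side of mean p has squared biases of total at most 2 log(1/p) (`sum_sq_bias_le`); summed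
over a partition this is an entropy, hence at most the logarithm of the number of rectangles. With
few rectangles most sides are therefore nearly unbiased at most i, the weight with true is at least
(3/4)^2 of the weight with false, and a wrong label on disjoint pairs stays wrong too often after i
is inserted. -/

/-! ### Rectangle partitions of pairs of sets and the search for a unique common element. -/

section Cube

variable {ι : Type*} [DecidableEq ι]

/-- Restricts `u` to the coordinates in `D`. -/
def mask (D u : ι → Bool) : ι → Bool := fun j => D j && u j

/-- The negated direction. -/
def flipBits (D : ι → Bool) : ι → Bool := fun j => !D j

theorem update_mask_update (D u : ι → Bool) (i : ι) (s t : Bool) :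
    Function.update (mask (Function.update D i t) u) i s = Function.update (mask D u) i s := by
  ext j; by_cases h : j = i
  · subst h; simp
  · simp [h, mask]

theorem flipBits_update (D : ι → Bool) (i : ι) (t : Bool) :
    flipBits (Function.update D i t) = Function.update (flipBits D) i (!t) := by
  ext j; by_cases h : j = i
  · subst h; simp [flipBits]
  · simp [h, flipBits]

theorem update_mask_of_mem (D u : ι → Bool) (i : ι) (s : Bool) (h : D i = true) :
    Function.update (mask D u) i s = mask D (Function.update u i s) := by
  ext j; by_cases hj : j = i
  · subst hj; simp [mask, h]
  · simp [hj, mask]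

theorem update_mask_of_not_mem (D u : ι → Bool) (i : ι) (h : D i = false) :
    Function.update (mask D u) i false = mask D u := by
  ext j; by_cases hj : j = i
  · subst hj; simp [mask, h]
  · simp [hj, mask]

theorem flipBits_flipBits {κ : Type*} (D : κ → Bool) : flipBits (flipBits D) = D := by ext; simp [flipBits]

variable [Fintype ι]

/-- The sign `1` or `-1` of a bit. -/
def bitSign (s : Bool) : ℝ := if s then 1 else -1

theorem sum_update_add_sum_update (g : (ι → Bool) → ℝ) (i : ι) :
    (∑ u, g (Function.update u i false)) + ∑ u, g (Function.update u i true) = 2 * ∑ u, g u := by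
  have hinv : Function.Involutive (fun u : ι → Bool => Function.update u i (!u i)) := by
    intro u; ext j; by_cases h : j = i
    · subst h; simp
    · simp [h]
  have h1 : ∑ u, g (Function.update u i (!u i)) = ∑ u, g u :=
    Equiv.sum_comp (hinv.toPerm _) g
  rw [← Finset.sum_add_distrib, two_mul]
  nth_rewrite 2 [← h1]
  rw [← Finset.sum_add_distrib]
  refine Finset.sum_congr rfl fun u _ => ?_
  have h2 : Function.update u i (u i) = u := Function.update_eq_self i u
  cases h : u i
  · rw [h] at h2; simp [h2]
  · rw [h] at h2; simp [h2, add_comm]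

theorem sum_exp_bitSign (β : ι → ℝ) :
    ∑ u : ι → Bool, Real.exp (∑ i, β i * bitSign (u i)) = ∏ i, (2 * Real.cosh (β i)) := by
  have h : ∀ i, 2 * Real.cosh (β i) = ∑ s : Bool, Real.exp (β i * bitSign s) := by
    intro i; simp [bitSign, Real.cosh_eq]; ring
  simp_rw [h, Real.exp_sum]
  rw [Finset.prod_univ_sum, Fintype.piFinset_univ]

/-- A function on the cube with values in `[0,1]` and a large mean has small biases. -/
theorem sum_sq_bias_le (g : (ι → Bool) → ℝ) (h0 : ∀ u, 0 ≤ g u) (h1 : ∀ u, g u ≤ 1)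
    (hpos : 0 < ∑ u, g u) :
    ∑ i, ((∑ u, g u * bitSign (u i)) / ∑ u, g u) ^ 2
      ≤ 2 * Real.log (2 ^ Fintype.card ι / ∑ u, g u) := by
  set G := ∑ u, g u with hG
  set β : ι → ℝ := fun i => (∑ u, g u * bitSign (u i)) / G with hβ
  set s := ∑ i, β i ^ 2 with hs
  set V : (ι → Bool) → ℝ := fun u => ∑ i, β i * bitSign (u i) with hV
  have hVs : ∑ u, g u * V u = G * s := by
    simp only [hV, Finset.mul_sum, hs]
    rw [Finset.sum_comm]
    refine Finset.sum_congr rfl fun i _ => ?_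
    have : ∑ u, g u * bitSign (u i) = β i * G := by simp only [hβ]; field_simp
    calc ∑ u, g u * (β i * bitSign (u i)) = β i * ∑ u, g u * bitSign (u i) := by
          rw [Finset.mul_sum]; exact Finset.sum_congr rfl fun u _ => by ring
      _ = _ := by rw [this]; ring
  -- The bound compares two estimates of the g-weighted exponential moment of V. Below: the tangent
  -- of exp at s, the g-average of V. Above: drop g ≤ 1 and use independence with cosh β ≤ exp (β^2
  -- / 2).
  have hlow : G * Real.exp s ≤ ∑ u, g u * Real.exp (V u) := by
    have : ∀ u, g u * (Real.exp s * (V u - s + 1)) ≤ g u * Real.exp (V u) := by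
      intro u
      refine mul_le_mul_of_nonneg_left ?_ (h0 u)
      have := Real.add_one_le_exp (V u - s)
      calc Real.exp s * (V u - s + 1) ≤ Real.exp s * Real.exp (V u - s) := by gcongr
        _ = _ := by rw [← Real.exp_add]; congr 1; ring
    refine le_trans (le_of_eq ?_) (Finset.sum_le_sum fun u _ => this u)
    have : ∀ u, g u * (Real.exp s * (V u - s + 1))
        = Real.exp s * (g u * V u) + Real.exp s * (1 - s) * g u := fun u => by ring
    simp_rw [this, Finset.sum_add_distrib, ← Finset.mul_sum, hVs, ← hG]; ring
  have hup : ∑ u, g u * Real.exp (V u) ≤ 2 ^ Fintype.card ι * Real.exp (s / 2) := by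
    calc ∑ u, g u * Real.exp (V u) ≤ ∑ u, Real.exp (V u) := by
          refine Finset.sum_le_sum fun u _ => ?_
          exact mul_le_of_le_one_left (Real.exp_pos _).le (h1 u)
      _ = ∏ i, (2 * Real.cosh (β i)) := sum_exp_bitSign β
      _ ≤ ∏ i, (2 * Real.exp (β i ^ 2 / 2)) := by
          refine Finset.prod_le_prod (fun i _ => by positivity) fun i _ => ?_
          have := Real.cosh_le_exp_half_sq (β i)
          gcongr
      _ = _ := by
          rw [Finset.prod_mul_distrib, ← Real.exp_sum, ← Finset.sum_div]; simp [hs]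
  have hexp : Real.exp (s / 2) ≤ 2 ^ Fintype.card ι / G := by
    rw [le_div_iff₀ hpos]
    have h3 := hlow.trans hup
    have h4 : Real.exp s = Real.exp (s / 2) * Real.exp (s / 2) := by
      rw [← Real.exp_add]; congr 1; ring
    rw [h4] at h3
    have h5 := Real.exp_pos (s / 2)
    nlinarith
  have := (Real.le_log_iff_exp_le (by positivity)).2 hexp
  linarith

/-- Entropy is at most the logarithm of the support size; termwise from log z ≤ z - 1 at z = 1 / (p
r * |T|). -/
theorem sum_mul_log_inv_le {R : Type*} (T : Finset R) (p : R → ℝ) (h0 : ∀ r ∈ T, 0 ≤ p r)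
    (h1 : ∑ r ∈ T, p r = 1) :
    ∑ r ∈ T, p r * Real.log (1 / p r) ≤ Real.log T.card := by
  have hT : 0 < (T.card : ℝ) := by
    rcases T.eq_empty_or_nonempty with h | h
    · simp [h] at h1
    · exact_mod_cast h.card_pos
  have h : ∀ r ∈ T, p r * Real.log (1 / p r) - p r * Real.log T.card ≤ 1 / T.card - p r := by
    intro r hr
    rcases (h0 r hr).eq_or_lt with h | h
    · rw [← h]; simp
    · have h2 := Real.log_le_sub_one_of_pos (x := 1 / p r / T.card) (by positivity)
      rw [Real.log_div (by positivity) hT.ne'] at h2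
      have h3 := mul_le_mul_of_nonneg_left h2 h.le
      have h4 : p r * (1 / p r / T.card - 1) = 1 / T.card - p r := by field_simp
      linarith
  have h2 := Finset.sum_le_sum h
  rw [Finset.sum_sub_distrib, Finset.sum_sub_distrib, ← Finset.sum_mul, h1] at h2
  rw [Finset.sum_const, nsmul_eq_mul, mul_one_div_cancel hT.ne'] at h2
  linarith

/-- The mean of `g` over a random restriction to `D` whose `i`-th bit is replaced by `s`. -/
noncomputable def maskMean (g : (ι → Bool) → ℝ) (D : ι → Bool) (i : ι) (s : Bool) : ℝ :=
  (∑ u, g (Function.update (mask D u) i s)) / 2 ^ Fintype.card ι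

/-- The mean of `g` over a random restriction to `D`. -/
noncomputable def mean (g : (ι → Bool) → ℝ) (D : ι → Bool) : ℝ :=
  (∑ u, g (mask D u)) / 2 ^ Fintype.card ι

theorem maskMean_update (g : (ι → Bool) → ℝ) (D : ι → Bool) (i : ι) (s t : Bool) :
    maskMean g (Function.update D i t) i s = maskMean g D i s := by
  simp [maskMean, update_mask_update]

/-- A coordinate outside D reads `false` anyway. This turns the factor of the party that does not
own i into a plain mean. -/
theorem maskMean_false_of_not_mem (g : (ι → Bool) → ℝ) (D : ι → Bool) (i : ι) (h : D i = false) :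
    maskMean g D i false = mean g D := by
  simp [maskMean, mean, update_mask_of_not_mem D _ i h]

theorem maskMean_add (g : (ι → Bool) → ℝ) (D : ι → Bool) (i : ι) (h : D i = true) :
    maskMean g D i false + maskMean g D i true = 2 * mean g D := by
  simp only [maskMean, mean, update_mask_of_mem D _ i _ h]
  rw [← add_div, sum_update_add_sum_update (fun u => g (mask D u)) i]; ring

theorem maskMean_sub (g : (ι → Bool) → ℝ) (D : ι → Bool) (i : ι) (h : D i = true) :
    maskMean g D i true - maskMean g D i false
      = 2 * ((∑ u, g (mask D u) * bitSign (u i)) / 2 ^ Fintype.card ι) := by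
  simp only [maskMean, update_mask_of_mem D _ i _ h]
  rw [← sub_div, ← mul_div_assoc,
    ← sum_update_add_sum_update (fun u => g (mask D u) * bitSign (u i)) i]
  simp [bitSign]; ring

theorem maskMean_nonneg (g : (ι → Bool) → ℝ) (h0 : ∀ u, 0 ≤ g u) (D : ι → Bool) (i : ι)
    (s : Bool) : 0 ≤ maskMean g D i s :=
  div_nonneg (Finset.sum_nonneg fun _ _ => h0 _) (by positivity)

theorem mean_nonneg (g : (ι → Bool) → ℝ) (h0 : ∀ u, 0 ≤ g u) (D : ι → Bool) :
    0 ≤ mean g D :=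
  div_nonneg (Finset.sum_nonneg fun _ _ => h0 _) (by positivity)

theorem mean_le_one (g : (ι → Bool) → ℝ) (h1 : ∀ u, g u ≤ 1) (D : ι → Bool) :
    mean g D ≤ 1 := by
  rw [mean, div_le_one (by positivity)]
  calc ∑ u, g (mask D u) ≤ ∑ u : ι → Bool, (1 : ℝ) := Finset.sum_le_sum fun u _ => h1 _
    _ = _ := by simp

theorem sum_sq_bias_mean_le (g : (ι → Bool) → ℝ) (h0 : ∀ u, 0 ≤ g u) (h1 : ∀ u, g u ≤ 1)
    (D : ι → Bool) :
    mean g D * ∑ i, ((∑ u, g (mask D u) * bitSign (u i)) / ∑ u, g (mask D u)) ^ 2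
      ≤ 2 * (mean g D * Real.log (1 / mean g D)) := by
  rcases (mean_nonneg g h0 D).eq_or_lt with h | h
  · rw [← h]; simp
  · have hs : 0 < ∑ u, g (mask D u) := by
      rw [mean] at h
      by_contra hh
      exact absurd h (not_lt.2 (div_nonpos_of_nonpos_of_nonneg (not_lt.1 hh) (by positivity)))
    have := sum_sq_bias_le (fun u => g (mask D u)) (fun u => h0 _) (fun u => h1 _) hs
    have h3 : 1 / mean g D = 2 ^ Fintype.card ι / ∑ u, g (mask D u) := by
      rw [mean, one_div_div]
    rw [h3]
    calc _ ≤ mean g D * (2 * Real.log (2 ^ Fintype.card ι / ∑ u, g (mask D u))) := by gcongr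
      _ = _ := by ring

/-- With r and p the means for `false` and `true`, the bias is (p - r) / (r + p) and the mean is (r
+ p) / 2. If p < 3r/4, then mean times squared bias exceeds r/56, so 98 leaves room to spare. -/
theorem maskMean_false_le_of_biased (g : (ι → Bool) → ℝ) (h0 : ∀ u, 0 ≤ g u)
    (D : ι → Bool) (i : ι) (h : D i = true)
    (hb : maskMean g D i true < 3 / 4 * maskMean g D i false) :
    maskMean g D i false ≤ 98 * (mean g D *
      ((∑ u, g (mask D u) * bitSign (u i)) / ∑ u, g (mask D u)) ^ 2) := by
  have hadd := maskMean_add g D i h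
  have hsub := maskMean_sub g D i h
  have h1 := maskMean_nonneg g h0 D i true
  have hc : (0 : ℝ) < 2 ^ Fintype.card ι := by positivity
  have hmp : 0 < mean g D := by linarith
  have hβ : (∑ u, g (mask D u) * bitSign (u i)) / ∑ u, g (mask D u)
      = (maskMean g D i true - maskMean g D i false) / (2 * mean g D) := by
    rw [hsub, mean, mul_div_mul_left _ _ (two_ne_zero), div_div_div_cancel_right₀ hc.ne']
  rw [hβ]
  set p := maskMean g D i true
  set r := maskMean g D i false
  have hm : mean g D = (r + p) / 2 := by linarith
  rw [hm] at hmp ⊢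
  have : 98 * ((r + p) / 2 * ((p - r) / (2 * ((r + p) / 2))) ^ 2) = 49 * (r - p) ^ 2 / (r + p) := by
    have : r + p ≠ 0 := by linarith
    field_simp; ring
  rw [this, le_div_iff₀ (by linarith)]
  nlinarith

/-- Since q ignores the i-th bit of D, i may be assigned to the party for which the estimate holds,
at the price of a factor 2. -/
theorem sum_le_two_mul_sum (i : ι) (q p : (ι → Bool) → ℝ)
    (hq : ∀ D, q (Function.update D i true) = q D) (hp : ∀ D, 0 ≤ p D)
    (hqp : ∀ D, D i = true → q D ≤ p D) : ∑ D, q D ≤ 2 * ∑ D, p D := by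
  calc ∑ D, q D = ∑ D, q (Function.update D i true) := by simp [hq]
    _ ≤ ∑ D, p (Function.update D i true) := Finset.sum_le_sum fun D _ => hqp _ (by simp)
    _ ≤ (∑ D, p (Function.update D i false)) + ∑ D, p (Function.update D i true) :=
        le_add_of_nonneg_left (Finset.sum_nonneg fun D _ => hp _)
    _ = _ := sum_update_add_sum_update p i

/-- For fixed D and E the two inputs are independent, so the probability of a rectangle factors and
these products form a distribution on T. -/
theorem mean_mul_mean_sum {R : Type*} (T : Finset R) (X Y : R → (ι → Bool) → ℝ)
    (hXY : ∀ x y, ∑ r ∈ T, X r x * Y r y = 1) (D E : ι → Bool) :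
    ∑ r ∈ T, mean (X r) D * mean (Y r) E = 1 := by
  have : ∀ r, mean (X r) D * mean (Y r) E = (∑ u, ∑ v, X r (mask D u) * Y r (mask E v))
      / (2 ^ Fintype.card ι * 2 ^ Fintype.card ι) := by
    intro r
    rw [mean, mean, div_mul_div_comm, Finset.sum_mul_sum]
  simp_rw [this, ← Finset.sum_div]
  rw [Finset.sum_comm]
  simp_rw [Finset.sum_comm (s := T), hXY]
  simp

theorem maskMean_mul_maskMean_sum {R : Type*} (T : Finset R) (X Y : R → (ι → Bool) → ℝ)
    (hXY : ∀ x y, ∑ r ∈ T, X r x * Y r y = 1) (D E : ι → Bool) (i : ι) (s t : Bool) :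
    ∑ r ∈ T, maskMean (X r) D i s * maskMean (Y r) E i t = 1 := by
  have : ∀ r, maskMean (X r) D i s * maskMean (Y r) E i t
      = (∑ u, ∑ v, X r (Function.update (mask D u) i s) * Y r (Function.update (mask E v) i t))
      / (2 ^ Fintype.card ι * 2 ^ Fintype.card ι) := by
    intro r
    rw [maskMean, maskMean, div_mul_div_comm, Finset.sum_mul_sum]
  simp_rw [this, ← Finset.sum_div]
  rw [Finset.sum_comm]
  simp_rw [Finset.sum_comm (s := T), hXY]
  simp

open Classical in
/-- On average, few rectangles have a left side that is biased towards `false`. -/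
theorem sum_biased_le {R : Type*} (T : Finset R) (X Y : R → (ι → Bool) → ℝ)
    (hX0 : ∀ r x, 0 ≤ X r x) (hX1 : ∀ r x, X r x ≤ 1)
    (hY0 : ∀ r x, 0 ≤ Y r x) (hY1 : ∀ r x, Y r x ≤ 1)
    (hXY : ∀ x y, ∑ r ∈ T, X r x * Y r y = 1) :
    ∑ i, ∑ D, ∑ r ∈ T, (if maskMean (X r) D i true < 3 / 4 * maskMean (X r) D i false then
      maskMean (X r) D i false * maskMean (Y r) (flipBits D) i false else 0)
      ≤ 392 * 2 ^ Fintype.card ι * Real.log T.card := by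
  set β : R → (ι → Bool) → ι → ℝ := fun r D i =>
    (∑ u, X r (mask D u) * bitSign (u i)) / ∑ u, X r (mask D u) with hβ
  have h1 : ∀ i, ∑ D, ∑ r ∈ T,
      (if maskMean (X r) D i true < 3 / 4 * maskMean (X r) D i false then
        maskMean (X r) D i false * maskMean (Y r) (flipBits D) i false else 0)
      ≤ 2 * ∑ D, ∑ r ∈ T, 98 * (mean (X r) D * β r D i ^ 2) * mean (Y r) (flipBits D) := by
    intro i
    refine sum_le_two_mul_sum i _ _ ?_ ?_ ?_
    · intro D; simp only [flipBits_update, maskMean_update]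
    · intro D
      refine Finset.sum_nonneg fun r _ => mul_nonneg ?_ (mean_nonneg _ (hY0 r) _)
      have := mean_nonneg _ (hX0 r) D
      positivity
    · intro D hD
      refine Finset.sum_le_sum fun r _ => ?_
      have hY := mean_nonneg _ (hY0 r) (flipBits D)
      split_ifs with hb
      · rw [maskMean_false_of_not_mem (Y r) (flipBits D) i (by simp [flipBits, hD])]
        exact mul_le_mul_of_nonneg_right
          (maskMean_false_le_of_biased (X r) (hX0 r) D i hD hb) hY
      · have := mean_nonneg _ (hX0 r) D
        positivity
  have h2 : ∀ D, ∑ i, ∑ r ∈ T, 98 * (mean (X r) D * β r D i ^ 2) * mean (Y r) (flipBits D)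
      ≤ 196 * Real.log T.card := by
    intro D
    rw [Finset.sum_comm]
    -- The left side alone gives log (1 / mean X). Enlarging it to the logarithm for the whole
    -- rectangle, by mean Y ≤ 1, makes the sum over r an entropy.
    have h3 : ∀ r ∈ T, ∑ i, 98 * (mean (X r) D * β r D i ^ 2) * mean (Y r) (flipBits D)
        ≤ 196 * ((mean (X r) D * mean (Y r) (flipBits D)) *
            Real.log (1 / (mean (X r) D * mean (Y r) (flipBits D)))) := by
      intro r _
      have hb := sum_sq_bias_mean_le (X r) (hX0 r) (hX1 r) D
      have hY := mean_nonneg _ (hY0 r) (flipBits D)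
      have hYl := mean_le_one _ (hY1 r) (flipBits D)
      have hX := mean_nonneg _ (hX0 r) D
      have e : ∑ i, 98 * (mean (X r) D * β r D i ^ 2) * mean (Y r) (flipBits D)
          = 98 * mean (Y r) (flipBits D) * (mean (X r) D * ∑ i, β r D i ^ 2) := by
        simp_rw [Finset.mul_sum]
        exact Finset.sum_congr rfl fun i _ => by ring
      rw [e]
      rcases hX.eq_or_lt with hx | hx
      · rw [← hx]; simp
      rcases hY.eq_or_lt with hy | hy
      · rw [← hy]; simp
      have hl : Real.log (1 / mean (X r) D)
          ≤ Real.log (1 / (mean (X r) D * mean (Y r) (flipBits D))) := by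
        apply Real.log_le_log (by positivity)
        apply one_div_le_one_div_of_le (by positivity)
        exact mul_le_of_le_one_right hX hYl
      calc _ ≤ 98 * mean (Y r) (flipBits D) * (2 * (mean (X r) D * Real.log (1 / mean (X r) D))) := by
            gcongr
        _ ≤ 98 * mean (Y r) (flipBits D) * (2 * (mean (X r) D *
              Real.log (1 / (mean (X r) D * mean (Y r) (flipBits D))))) := by gcongr
        _ = _ := by ring
    refine (Finset.sum_le_sum h3).trans ?_
    rw [← Finset.mul_sum]
    have := sum_mul_log_inv_le T (fun r => mean (X r) D * mean (Y r) (flipBits D))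
      (fun r _ => mul_nonneg (mean_nonneg _ (hX0 r) D) (mean_nonneg _ (hY0 r) _))
      (mean_mul_mean_sum T X Y hXY D (flipBits D))
    gcongr
  calc _ ≤ ∑ i, 2 * ∑ D, ∑ r ∈ T, 98 * (mean (X r) D * β r D i ^ 2) * mean (Y r) (flipBits D) :=
        Finset.sum_le_sum fun i _ => h1 i
    _ = 2 * ∑ D, ∑ i, ∑ r ∈ T, 98 * (mean (X r) D * β r D i ^ 2) * mean (Y r) (flipBits D) := by
        rw [← Finset.mul_sum, Finset.sum_comm]
    _ ≤ 2 * ∑ D : ι → Bool, 196 * Real.log T.card := by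
        gcongr with D; exact h2 D
    _ = _ := by simp; ring

open Classical in
/-- If the classes of a partition of the pairs into rectangles are labelled with coordinates, so
that the label of a random pair of sets that meet in a single coordinate is this coordinate with
probability at least `2/3`, then there are many classes. -/
theorem card_le_log_of_label {R : Type*} (T : Finset R) (X Y : R → (ι → Bool) → ℝ)
    (hX0 : ∀ r x, 0 ≤ X r x) (hX1 : ∀ r x, X r x ≤ 1)
    (hY0 : ∀ r x, 0 ≤ Y r x) (hY1 : ∀ r x, Y r x ≤ 1)
    (hXY : ∀ x y, ∑ r ∈ T, X r x * Y r y = 1) (out : R → Option ι)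
    (hs : 2 / 3 * (Fintype.card ι * 2 ^ Fintype.card ι) ≤
      ∑ i, ∑ D, ∑ r ∈ T, (if out r = some i then
        maskMean (X r) D i true * maskMean (Y r) (flipBits D) i true else 0)) :
    (11 / 27 : ℝ) * Fintype.card ι ≤ 4 + 784 * Real.log T.card := by
  set a : Bool → ι → (ι → Bool) → R → ℝ := fun s i D r =>
    maskMean (X r) D i s * maskMean (Y r) (flipBits D) i s with ha
  have ha0 : ∀ s i D r, 0 ≤ a s i D r := fun s i D r =>
    mul_nonneg (maskMean_nonneg _ (hX0 r) _ _ _) (maskMean_nonneg _ (hY0 r) _ _ _)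
  have hb1 := sum_biased_le T X Y hX0 hX1 hY0 hY1 hXY
  have hb2 := sum_biased_le T Y X hY0 hY1 hX0 hX1 (fun x y => by
    simpa [mul_comm] using hXY y x)
  -- The bound for the other party, reindexed by D ↦ `flipBits D` so that both are sums over the
  -- same direction.
  have hb2' : ∑ i, ∑ D, ∑ r ∈ T,
      (if maskMean (Y r) (flipBits D) i true < 3 / 4 * maskMean (Y r) (flipBits D) i false then
        a false i D r else 0)
      ≤ 392 * 2 ^ Fintype.card ι * Real.log T.card := by
    refine le_trans (le_of_eq ?_) hb2
    refine Finset.sum_congr rfl fun i _ => ?_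
    have hinv : Function.Involutive (flipBits : (ι → Bool) → (ι → Bool)) := flipBits_flipBits
    rw [← Equiv.sum_comp (hinv.toPerm _)]
    refine Finset.sum_congr rfl fun D _ => Finset.sum_congr rfl fun r _ => ?_
    simp [ha, flipBits_flipBits, mul_comm]
  -- Forcing coordinate i to `false` at most doubles the weight of a random disjoint pair. Each r
  -- has at most one label, so the sum over i costs nothing more; the other factor 2 comes from the
  -- choice of the owner of i.
  have hout : ∑ i, ∑ D, ∑ r ∈ T, (if out r = some i then a false i D r else 0)
      ≤ 4 * 2 ^ Fintype.card ι := by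
    have h1 : ∀ i, ∑ D, ∑ r ∈ T, (if out r = some i then a false i D r else 0)
        ≤ 2 * ∑ D, ∑ r ∈ T, (if out r = some i then
          2 * (mean (X r) D * mean (Y r) (flipBits D)) else 0) := by
      intro i
      refine sum_le_two_mul_sum i _ _ ?_ ?_ ?_
      · intro D; simp only [ha, flipBits_update, maskMean_update]
      · intro D
        refine Finset.sum_nonneg fun r _ => ?_
        have := mean_nonneg _ (hX0 r) D
        have := mean_nonneg _ (hY0 r) (flipBits D)
        split_ifs <;> positivity
      · intro D hD
        refine Finset.sum_le_sum fun r _ => ?_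
        split_ifs with h
        · simp only [ha]
          rw [maskMean_false_of_not_mem (Y r) (flipBits D) i (by simp [flipBits, hD]), ← mul_assoc]
          refine mul_le_mul_of_nonneg_right ?_ (mean_nonneg _ (hY0 r) _)
          have := maskMean_add (X r) D i hD
          have := maskMean_nonneg (X r) (hX0 r) D i true
          linarith
        · exact le_rfl
    have h2 : ∀ D, ∑ i, ∑ r ∈ T, (if out r = some i then
          2 * (mean (X r) D * mean (Y r) (flipBits D)) else 0) ≤ 2 := by
      intro D
      rw [Finset.sum_comm]
      calc _ ≤ ∑ r ∈ T, 2 * (mean (X r) D * mean (Y r) (flipBits D)) := by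
            refine Finset.sum_le_sum fun r _ => ?_
            have := mean_nonneg _ (hX0 r) D
            have := mean_nonneg _ (hY0 r) (flipBits D)
            cases h : out r with
            | none => simp; positivity
            | some j => simp
        _ = 2 := by rw [← Finset.mul_sum, mean_mul_mean_sum T X Y hXY]; ring
    calc _ ≤ _ := Finset.sum_le_sum fun i _ => h1 i
      _ = 2 * ∑ D, ∑ i, ∑ r ∈ T, (if out r = some i then
          2 * (mean (X r) D * mean (Y r) (flipBits D)) else 0) := by
        rw [← Finset.mul_sum, Finset.sum_comm]
      _ ≤ 2 * ∑ D : ι → Bool, 2 := by gcongr with D; exact h2 D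
      _ = _ := by simp; ring
  -- A class with another label and no bias on either side keeps at least 9/16 = (3/4)^2 of its
  -- `false` weight, and this weight is an error. The three subtracted sums remove the remaining
  -- classes.
  have key : ∀ i D, ∑ r ∈ T, (if out r = some i then a true i D r else 0) ≤
      1 - 9 / 16 * (1 - ∑ r ∈ T, (if out r = some i then a false i D r else 0)
        - ∑ r ∈ T, (if maskMean (X r) D i true < 3 / 4 * maskMean (X r) D i false then
          a false i D r else 0)
        - ∑ r ∈ T, (if maskMean (Y r) (flipBits D) i true < 3 / 4 * maskMean (Y r) (flipBits D) i false then
          a false i D r else 0)) := by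
    intro i D
    have e1 : ∑ r ∈ T, a true i D r = 1 := maskMean_mul_maskMean_sum T X Y hXY D (flipBits D) i _ _
    have e0 : ∑ r ∈ T, a false i D r = 1 := maskMean_mul_maskMean_sum T X Y hXY D (flipBits D) i _ _
    rw [← e0, ← Finset.sum_sub_distrib, ← Finset.sum_sub_distrib, ← Finset.sum_sub_distrib, e0,
      ← e1, Finset.mul_sum, ← Finset.sum_sub_distrib]
    refine Finset.sum_le_sum fun r _ => ?_
    have p0 := ha0 false i D r
    have p1 := ha0 true i D r
    by_cases h1 : out r = some i
    · simp only [h1, if_true]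
      split_ifs <;> linarith
    · simp only [h1, if_false]
      split_ifs with h2 h3
      · linarith
      · linarith
      · linarith
      · simp only [ha] at *
        push Not at h2
        have hx := maskMean_nonneg _ (hX0 r) D i false
        have hy := maskMean_nonneg _ (hY0 r) (flipBits D) i false
        have := mul_le_mul h2 (not_lt.1 ‹_›) (by positivity) (maskMean_nonneg _ (hX0 r) D i true)
        linarith
  have h3 := Finset.sum_le_sum fun i (_ : i ∈ Finset.univ) =>
    Finset.sum_le_sum fun D (_ : D ∈ Finset.univ) => key i D
  simp only [Finset.sum_sub_distrib, ← Finset.mul_sum] at h3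
  simp only [Finset.sum_const, Finset.card_univ, Fintype.card_fun, Fintype.card_bool,
    nsmul_eq_mul, Nat.cast_pow, Nat.cast_ofNat, mul_one] at h3
  have h4 := hs.trans h3
  simp only [ha] at *
  have hc : (0 : ℝ) < 2 ^ Fintype.card ι := by positivity
  -- Here 11/27 = (2/3 - 7/16) / (9/16), and 784 = 2 * 392 accounts for the two parties.
  have h5 : (11 / 27 * (Fintype.card ι : ℝ)) * 2 ^ Fintype.card ι
      ≤ (4 + 784 * Real.log T.card) * 2 ^ Fintype.card ι := by
    linarith
  exact le_of_mul_le_mul_right h5 hc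

end Cube

/-! ### Records of executions: rectangle property and counting. -/

section Records

variable {n : ℕ} {E κ : Type*}

/-- The events of an execution, each query answer `S` being replaced by the event `ev S`, together
with the label of the contract that is output. Bits appear as `inl`, query events as `inr`. -/
def Protocol.record (br : Oracle n) (f c : SetFn n) (ev : Finset (Fin n) → E)
    (label : unitInterval → κ) :
    Protocol n → List (Finset (Fin n)) → List (Finset (Fin n)) → List (Bool ⊕ E) × κ
  | .aliceOutput act, la, _ =>
      let r := (act f la).run (br f c)
      (r.2.map (fun S => Sum.inr (ev S)), label r.1)
  | .bobOutput act, _, lb =>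
      let r := (act c lb).run (br f c)
      (r.2.map (fun S => Sum.inr (ev S)), label r.1)
  | .aliceSend act next, la, lb =>
      let r := (act f la).run (br f c)
      let o := (next r.1).record br f c ev label (la ++ r.2) lb
      (r.2.map (fun S => Sum.inr (ev S)) ++ Sum.inl r.1 :: o.1, o.2)
  | .bobSend act next, la, lb =>
      let r := (act c lb).run (br f c)
      let o := (next r.1).record br f c ev label la (lb ++ r.2)
      (r.2.map (fun S => Sum.inr (ev S)) ++ Sum.inl r.1 :: o.1, o.2)

theorem Protocol.record_snd (br : Oracle n) (f c : SetFn n) (ev : Finset (Fin n) → E)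
    (label : unitInterval → κ) (P : Protocol n) (la lb : List (Finset (Fin n))) :
    (P.record br f c ev label la lb).2 = label (P.run br f c la lb).contract := by
  induction P generalizing la lb with
  | aliceOutput act => rfl
  | bobOutput act => rfl
  | aliceSend act next ih => simpa [Protocol.record, Protocol.run] using ih _ _ _
  | bobSend act next ih => simpa [Protocol.record, Protocol.run] using ih _ _ _

theorem countP_isLeft_map_inr (ev : Finset (Fin n) → E) (l : List (Finset (Fin n))) :
    (l.map (fun S => (Sum.inr (ev S) : Bool ⊕ E))).countP Sum.isLeft = 0 := by
  induction l <;> simp_all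

theorem countP_isRight_map_inr (ev : Finset (Fin n) → E) (l : List (Finset (Fin n))) :
    (l.map (fun S => (Sum.inr (ev S) : Bool ⊕ E))).countP Sum.isRight = l.length := by
  rw [List.countP_map]; exact List.countP_eq_length.2 (by simp)

theorem Protocol.record_countP_isLeft (br : Oracle n) (f c : SetFn n) (ev : Finset (Fin n) → E)
    (label : unitInterval → κ) (P : Protocol n) (la lb : List (Finset (Fin n))) :
    (P.record br f c ev label la lb).1.countP Sum.isLeft = (P.run br f c la lb).bits := by
  induction P generalizing la lb with
  | aliceOutput act => simp only [Protocol.record, Protocol.run, countP_isLeft_map_inr]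
  | bobOutput act => simp only [Protocol.record, Protocol.run, countP_isLeft_map_inr]
  | aliceSend act next ih =>
    simp only [Protocol.record, Protocol.run, List.countP_append, countP_isLeft_map_inr,
      List.countP_cons, ih]
    simp
  | bobSend act next ih =>
    simp only [Protocol.record, Protocol.run, List.countP_append, countP_isLeft_map_inr,
      List.countP_cons, ih]
    simp

theorem Protocol.record_countP_isRight (br : Oracle n) (f c : SetFn n) (ev : Finset (Fin n) → E)
    (label : unitInterval → κ) (P : Protocol n) (la lb : List (Finset (Fin n))) :
    (P.record br f c ev label la lb).1.countP Sum.isRight + la.length + lb.length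
      = (P.run br f c la lb).queries := by
  induction P generalizing la lb with
  | aliceOutput act =>
    simp only [Protocol.record, Protocol.run, countP_isRight_map_inr, List.length_append]; omega
  | bobOutput act =>
    simp only [Protocol.record, Protocol.run, countP_isRight_map_inr, List.length_append]; omega
  | aliceSend act next ih =>
    simp only [Protocol.record, Protocol.run, List.countP_append, countP_isRight_map_inr,
      List.countP_cons, ← ih, List.length_append]
    simp; omega
  | bobSend act next ih =>
    simp only [Protocol.record, Protocol.run, List.countP_append, countP_isRight_map_inr,
      List.countP_cons, ← ih, List.length_append]
    simp; omega

/-- Two runs with the same events, up to the first bit, agree. -/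
theorem QueryProg.run_eq_of_map_append_eq {β : Type} {O O' O'' : unitInterval → Finset (Fin n)}
    {ev ev' ev'' : Finset (Fin n) → E}
    (hS : ∀ S S', ev S = ev' S' → S = S')
    (p p' : QueryProg n β) (t t' : List (Bool ⊕ E))
    (ht : ∀ e l, t ≠ Sum.inr e :: l) (ht' : ∀ e l, t' ≠ Sum.inr e :: l)
    (hO : ∀ S, ev S = ev' S → ev'' S = ev S ∧ ∀ α, O α = S → O'' α = S)
    (h : (p.run O).2.map (fun S => (Sum.inr (ev S) : Bool ⊕ E)) ++ t
      = (p'.run O').2.map (fun S => Sum.inr (ev' S)) ++ t') :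
    (p.run O).2 = (p'.run O').2 ∧ t = t' ∧ p.run O'' = p.run O ∧
      (p.run O).2.map (fun S => (Sum.inr (ev'' S) : Bool ⊕ E))
        = (p.run O).2.map (fun S => (Sum.inr (ev S) : Bool ⊕ E)) := by
  induction p generalizing p' with
  | ret b =>
    cases p' with
    | ret b' => simpa [QueryProg.run] using h
    | ask α' next' =>
      simp only [QueryProg.run, List.map_nil, List.nil_append, List.map_cons,
        List.cons_append] at h
      exact absurd h (ht _ _)
  | ask α next ih =>
    cases p' with
    | ret b' =>
      simp only [QueryProg.run, List.map_nil, List.nil_append, List.map_cons,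
        List.cons_append] at h
      exact absurd h.symm (ht' _ _)
    | ask α' next' =>
      simp only [QueryProg.run, List.map_cons, List.cons_append, List.cons.injEq,
        Sum.inr.injEq] at h
      obtain ⟨h1, h2⟩ := h
      have hSS := hS _ _ h1
      rw [← hSS] at h1
      obtain ⟨e1, e2⟩ := hO _ h1
      obtain ⟨i1, i2, i3, i4⟩ := ih _ _ h2
      have e3 := e2 α rfl
      exact ⟨List.cons_eq_cons.2 ⟨hSS, i1⟩, i2, by simp only [QueryProg.run, e3, i3],
        by simp only [QueryProg.run, List.map_cons, i4, e1]⟩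

/-- The executions with a given record form a rectangle, provided that the events separate the
answers and that the answers are locally determined. -/
theorem Protocol.record_eq_of_record_eq (br : Oracle n) (f f' c c' : SetFn n)
    (ev ev' ev'' : Finset (Fin n) → E) (label : unitInterval → κ)
    (hS : ∀ S S', ev S = ev' S' → S = S')
    (hloc : ∀ S, ev S = ev' S → ev'' S = ev S ∧
      ∀ α, (br f c α = S → br f c' α = S) ∧ (br f' c' α = S → br f c' α = S))
    (P : Protocol n) (la lb : List (Finset (Fin n)))
    (h : P.record br f c ev label la lb = P.record br f' c' ev' label la lb) :
    P.record br f c' ev'' label la lb = P.record br f c ev label la lb := by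
  have hO : ∀ S, ev S = ev' S → ev'' S = ev S ∧
      ∀ α, br f c α = S → br f c' α = S :=
    fun S hs => ⟨(hloc S hs).1, fun α => ((hloc S hs).2 α).1⟩
  have hS' : ∀ S S', ev' S = ev S' → S = S' := fun S S' hs => (hS S' S hs.symm).symm
  have hO' : ∀ S, ev' S = ev S → ev'' S = ev' S ∧
      ∀ α, br f' c' α = S → br f c' α = S :=
    fun S hs => ⟨(hloc S hs.symm).1.trans hs.symm, fun α => ((hloc S hs.symm).2 α).2⟩
  induction P generalizing la lb with
  | aliceOutput act =>
    simp only [Protocol.record, Prod.mk.injEq] at h ⊢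
    obtain ⟨h1, h2⟩ := h
    have := QueryProg.run_eq_of_map_append_eq hS (act f la) (act f' la) [] []
      (by simp) (by simp) hO (by simpa using h1)
    obtain ⟨i1, i2, i3, i4⟩ := this
    rw [i3, i4]; simp
  | bobOutput act =>
    simp only [Protocol.record, Prod.mk.injEq] at h ⊢
    obtain ⟨h1, h2⟩ := h
    -- Bob holds c' in the mixed execution, so his moves are compared with those on (f', c'), while
    -- Alice's are compared with those on (f, c).
    have := QueryProg.run_eq_of_map_append_eq hS' (act c' lb) (act c lb) [] []
      (by simp) (by simp) hO' (by simpa using h1.symm)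
    obtain ⟨i1, i2, i3, i4⟩ := this
    rw [i3, i4, h2, h1]; simp
  | aliceSend act next ih =>
    simp only [Protocol.record, Prod.mk.injEq] at h ⊢
    obtain ⟨h1, h2⟩ := h
    have := QueryProg.run_eq_of_map_append_eq hS (act f la) (act f' la) _ _
      (by simp) (by simp) hO h1
    obtain ⟨i1, i2, i3, i4⟩ := this
    simp only [List.cons.injEq, Sum.inl.injEq] at i2
    have := ih _ _ _ (Prod.ext (by rw [i2.2, i1, i2.1]) (by rw [h2, i1, i2.1]))
    rw [i3, i4, this]; simp
  | bobSend act next ih =>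
    simp only [Protocol.record, Prod.mk.injEq] at h ⊢
    obtain ⟨h1, h2⟩ := h
    have := QueryProg.run_eq_of_map_append_eq hS' (act c' lb) (act c lb) _ _
      (by simp) (by simp) hO' h1.symm
    obtain ⟨i1, i2, i3, i4⟩ := this
    simp only [List.cons.injEq, Sum.inl.injEq] at i2
    have := ih (QueryProg.run (br f' c') (act c' lb)).1 la
      (lb ++ (QueryProg.run (br f' c') (act c' lb)).2)
      (Prod.ext (i2.2.trans (by rw [i1, i2.1])).symm (by rw [i1, i2.1] at h2 ⊢; exact h2))
    rw [i3, i4, this, h1, i2.2, i1, i2.1]; simp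

open Classical in
/-- The lists with at most `B` bits and at most `q` events. -/
noncomputable def boundedLists (E : Type*) [Fintype E] : ℕ → ℕ → Finset (List (Bool ⊕ E))
  | 0, 0 => {[]}
  | 0, q + 1 => insert [] ((Finset.univ ×ˢ boundedLists E 0 q).image
      fun p : E × List (Bool ⊕ E) => Sum.inr p.1 :: p.2)
  | B + 1, 0 => insert [] ((Finset.univ ×ˢ boundedLists E B 0).image
      fun p : Bool × List (Bool ⊕ E) => Sum.inl p.1 :: p.2)
  | B + 1, q + 1 => insert [] (((Finset.univ ×ˢ boundedLists E B (q + 1)).image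
      fun p : Bool × List (Bool ⊕ E) => Sum.inl p.1 :: p.2) ∪
      ((Finset.univ ×ˢ boundedLists E (B + 1) q).image
      fun p : E × List (Bool ⊕ E) => Sum.inr p.1 :: p.2))

theorem mem_boundedLists [Fintype E] (B q : ℕ) (l : List (Bool ⊕ E))
    (hB : l.countP Sum.isLeft ≤ B) (hq : l.countP Sum.isRight ≤ q) : l ∈ boundedLists E B q := by
  induction l generalizing B q with
  | nil => rcases B with _ | B <;> rcases q with _ | q <;> simp [boundedLists]
  | cons t l ih =>
    rcases t with b | e
    · simp only [List.countP_cons, Sum.isLeft_inl, Sum.isRight_inl, if_true] at hB hq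
      obtain ⟨B, rfl⟩ : ∃ B', B = B' + 1 := ⟨B - 1, by omega⟩
      have := ih B q (by omega) (by simpa using hq)
      rcases q with _ | q <;> simp [boundedLists, this]
    · simp only [List.countP_cons, Sum.isLeft_inr, Sum.isRight_inr, if_true] at hB hq
      obtain ⟨q, rfl⟩ : ∃ q', q = q' + 1 := ⟨q - 1, by omega⟩
      have := ih B q (by simpa using hB) (by omega)
      rcases B with _ | B <;> simp [boundedLists, this]

/-- A first entry costs a factor 2 and one unit of B, or a factor |E| and one unit of q. The base 4
in place of 2 and the spare 4 in front of |E| make each option at most half or a quarter of the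
target, leaving room for the empty list. -/
theorem card_boundedLists_le [Fintype E] [Nonempty E] (B q : ℕ) :
    (boundedLists E B q).card ≤ 4 * 4 ^ B * (4 * Fintype.card E) ^ q := by
  classical
  have hE : 1 ≤ Fintype.card E := Fintype.card_pos
  have ha : ∀ s : Finset (List (Bool ⊕ E)), ((Finset.univ ×ˢ s).image
      fun p : Bool × List (Bool ⊕ E) => (Sum.inl p.1 : Bool ⊕ E) :: p.2).card ≤ 2 * s.card :=
    fun s => Finset.card_image_le.trans (by simp [Finset.card_product])
  have hb : ∀ s : Finset (List (Bool ⊕ E)), ((Finset.univ ×ˢ s).image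
      fun p : E × List (Bool ⊕ E) => (Sum.inr p.1 : Bool ⊕ E) :: p.2).card
        ≤ Fintype.card E * s.card :=
    fun s => Finset.card_image_le.trans (by simp [Finset.card_product])
  have hpos : ∀ B q : ℕ, 1 ≤ 4 ^ B * (4 * Fintype.card E) ^ q := fun B q =>
    Nat.one_le_iff_ne_zero.2 (by positivity)
  induction B generalizing q with
  | zero =>
    induction q with
    | zero => simp [boundedLists]
    | succ q ih =>
      rw [boundedLists]
      have h1 := Finset.card_insert_le ([] : List (Bool ⊕ E)) ((Finset.univ ×ˢ boundedLists E 0 q).image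
        fun p : E × List (Bool ⊕ E) => Sum.inr p.1 :: p.2)
      have h2 := hb (boundedLists E 0 q)
      have h3 := Nat.mul_le_mul_left (Fintype.card E) ih
      have h4 := hpos 0 q
      have h5 : 4 * 4 ^ 0 * (4 * Fintype.card E) ^ (q + 1)
        = 4 * (Fintype.card E * (4 * 4 ^ 0 * (4 * Fintype.card E) ^ q)) := by ring
      have h6 : 1 ≤ Fintype.card E * (4 * 4 ^ 0 * (4 * Fintype.card E) ^ q) :=
        Nat.one_le_iff_ne_zero.2 (by positivity)
      omega
  | succ B ihB =>
    induction q with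
    | zero =>
      rw [boundedLists]
      have h1 := Finset.card_insert_le ([] : List (Bool ⊕ E)) ((Finset.univ ×ˢ boundedLists E B 0).image
        fun p : Bool × List (Bool ⊕ E) => Sum.inl p.1 :: p.2)
      have h2 := ha (boundedLists E B 0)
      have h3 := ihB 0
      have h4 : 1 ≤ 4 ^ B := Nat.one_le_pow _ _ (by norm_num)
      simp only [pow_zero, mul_one, pow_succ] at h3 ⊢
      omega
    | succ q ih =>
      rw [boundedLists]
      have h1 := Finset.card_insert_le ([] : List (Bool ⊕ E))
        (((Finset.univ ×ˢ boundedLists E B (q + 1)).image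
        fun p : Bool × List (Bool ⊕ E) => Sum.inl p.1 :: p.2) ∪
        ((Finset.univ ×ˢ boundedLists E (B + 1) q).image
        fun p : E × List (Bool ⊕ E) => Sum.inr p.1 :: p.2))
      have h1' := Finset.card_union_le ((Finset.univ ×ˢ boundedLists E B (q + 1)).image
        fun p : Bool × List (Bool ⊕ E) => (Sum.inl p.1 : Bool ⊕ E) :: p.2)
        ((Finset.univ ×ˢ boundedLists E (B + 1) q).image
        fun p : E × List (Bool ⊕ E) => (Sum.inr p.1 : Bool ⊕ E) :: p.2)
      have h2 := ha (boundedLists E B (q + 1))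
      have h2' := hb (boundedLists E (B + 1) q)
      have h3 := ihB (q + 1)
      have h3' := Nat.mul_le_mul_left (Fintype.card E) ih
      have e1 : 4 * 4 ^ (B + 1) * (4 * Fintype.card E) ^ (q + 1)
        = 4 * (4 * 4 ^ B * (4 * Fintype.card E) ^ (q + 1)) := by ring
      have e2 : 4 * 4 ^ (B + 1) * (4 * Fintype.card E) ^ (q + 1)
        = 4 * (Fintype.card E * (4 * 4 ^ (B + 1) * (4 * Fintype.card E) ^ q)) := by ring
      have h4 := hpos B (q + 1)
      have h5 : 4 * 4 ^ B * (4 * Fintype.card E) ^ (q + 1)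
        = 4 * (4 ^ B * (4 * Fintype.card E) ^ (q + 1)) := by ring
      omega

end Records

/-! ### From protocols to rectangle partitions. -/

open Classical in
/-- Finitely many events of probability at most `1/3` have a common sample point, outside any given
null set, that lies in at most a third of them. -/
theorem exists_card_filter_mem_le {Ω : Type*} [MeasurableSpace Ω] (μ : Measure Ω)
    [IsProbabilityMeasure μ] {σ : Type*} [Fintype σ] (bad : σ → Set Ω)
    (hbad : ∀ s, μ (bad s) ≤ 1 / 3) (p : Ω → Prop) (hp : ∀ᵐ ω ∂μ, p ω) :
    ∃ ω, p ω ∧ 3 * (Finset.univ.filter fun s => ω ∈ bad s).card ≤ Fintype.card σ := by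
  -- The bad events need not be measurable, so measurable hulls of the same measure are counted
  -- instead.
  set φ : Ω → ENNReal := fun ω => ∑ s, (toMeasurable μ (bad s)).indicator 1 ω with hφ
  have hm : ∀ s, Measurable ((toMeasurable μ (bad s)).indicator (1 : Ω → ENNReal)) := fun s =>
    measurable_one.indicator (measurableSet_toMeasurable _ _)
  have hint : ∫⁻ ω, φ ω ∂μ ≤ (Fintype.card σ : ENNReal) * (1 / 3) := by
    rw [lintegral_finsetSum _ fun s _ => hm s]
    calc _ = ∑ s, μ (bad s) := by
          refine Finset.sum_congr rfl fun s _ => ?_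
          rw [lintegral_indicator_one (measurableSet_toMeasurable _ _), measure_toMeasurable]
      _ ≤ ∑ s : σ, (1 / 3 : ENNReal) := Finset.sum_le_sum fun s _ => hbad s
      _ = _ := by simp
  obtain ⟨ω, hω, hle⟩ := exists_notMem_null_le_lintegral
    (Finset.aemeasurable_fun_sum _ fun s _ => (hm s).aemeasurable) hp
  refine ⟨ω, by simpa using hω, ?_⟩
  have h1 : ((Finset.univ.filter fun s => ω ∈ bad s).card : ENNReal) ≤ φ ω := by
    rw [Finset.card_filter, hφ]
    push_cast
    refine Finset.sum_le_sum fun s _ => ?_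
    split_ifs with h
    · rw [Set.indicator_of_mem (subset_toMeasurable _ _ h)]; simp
    · exact zero_le
  have h2 := (h1.trans hle).trans hint
  have h3 : (3 : ENNReal) * (Finset.univ.filter fun s => ω ∈ bad s).card ≤ Fintype.card σ := by
    calc _ ≤ 3 * ((Fintype.card σ : ENNReal) * (1 / 3)) := by gcongr
      _ = Fintype.card σ * (3 * (1 / 3)) := by ring
      _ = _ := by rw [one_div, ENNReal.mul_inv_cancel (by simp) (by simp), mul_one]
  exact_mod_cast h3

/-- A family of instances, indexed by pairs of subsets of `ι`, on which the best responses reveal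
little and the optimal contract reveals the common element of two sets that meet once. -/
structure HardFamily (n b : ℕ) (br : Oracle n) (ι E : Type*) where
  f : (ι → Bool) → SetFn n
  c : (ι → Bool) → SetFn n
  admissible_f : ∀ x, IsAdmissible b (f x)
  admissible_c : ∀ y, IsAdmissible b (c y)
  ev : (ι → Bool) → (ι → Bool) → Finset (Fin n) → E
  ev_injective : ∀ x y x' y' S S', ev x y S = ev x' y' S' → S = S'
  ev_local : ∀ x y x' y' S, ev x y S = ev x' y' S → ev x y' S = ev x y S ∧
    ∀ α, (br (f x) (c y) α = S → br (f x) (c y') α = S) ∧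
      (br (f x') (c y') α = S → br (f x) (c y') α = S)
  label : unitInterval → Option ι
  label_eq : ∀ i x y, x i = true → y i = true → (∀ j, j ≠ i → ¬ (x j = true ∧ y j = true)) →
    ∀ α, IsOptimalContract (f x) (c y) α → label α = some i

-- Fixing the shared randomness at a value that errs on at most a third of the sampled meeting pairs
-- leaves a deterministic protocol. Its records are the classes for `card_le_log_of_label`; since a
-- record contains the output label, the count gains a factor |ι| + 1.
set_option maxHeartbeats 1000000 in
open Classical in
theorem HardFamily.card_le {n b : ℕ} {br : Oracle n} {ι E : Type*} [Fintype ι]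
    [Fintype E] [Nonempty E] (H : HardFamily n b br ι E)
    {Ω : Type*} [MeasurableSpace Ω] (μ : Measure Ω) [IsProbabilityMeasure μ]
    (P : Ω → Protocol n) (hP : ComputesOptimalContract b br μ P) (q B : ℕ)
    (hq : QueriesAtMost b br μ P q) (hB : BitsAtMost b br μ P B) :
    (11 / 27 : ℝ) * Fintype.card ι ≤ 4 + 784 * Real.log
      ((4 * 4 ^ B * (4 * Fintype.card E) ^ q * (Fintype.card ι + 1) : ℕ) : ℝ) := by
  set xs : ι × (ι → Bool) × (ι → Bool) × (ι → Bool) → (ι → Bool) := fun s =>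
    Function.update (mask s.2.1 s.2.2.1) s.1 true with hxs
  set ys : ι × (ι → Bool) × (ι → Bool) × (ι → Bool) → (ι → Bool) := fun s =>
    Function.update (mask (flipBits s.2.1) s.2.2.2) s.1 true with hys
  have hmeet : ∀ s j, j ≠ s.1 → ¬ (xs s j = true ∧ ys s j = true) := by
    intro s j hj
    simp only [hxs, hys, Function.update_of_ne hj, mask, flipBits]
    cases s.2.1 j <;> simp
  obtain ⟨ω, hω, hcard⟩ := exists_card_filter_mem_le μ
    (fun s : ι × (ι → Bool) × (ι → Bool) × (ι → Bool) =>
      {ω | ¬ IsOptimalContract (H.f (xs s)) (H.c (ys s))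
        ((P ω).exec br (H.f (xs s)) (H.c (ys s))).contract})
    (fun s => hP _ _ (H.admissible_f _) (H.admissible_c _))
    (fun ω => ∀ x y, ((P ω).exec br (H.f x) (H.c y)).queries ≤ q ∧
      ((P ω).exec br (H.f x) (H.c y)).bits ≤ B)
    (by
      rw [ae_all_iff]; intro x; rw [ae_all_iff]; intro y
      exact (hq _ _ (H.admissible_f x) (H.admissible_c y)).and
        (hB _ _ (H.admissible_f x) (H.admissible_c y)))
  set rec : (ι → Bool) → (ι → Bool) → List (Bool ⊕ E) × Option ι := fun x y =>
    (P ω).record br (H.f x) (H.c y) (H.ev x y) H.label [] [] with hrec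
  have hrect : ∀ x y x' y', rec x y = rec x' y' → rec x y' = rec x y := by
    intro x y x' y' h
    exact Protocol.record_eq_of_record_eq br (H.f x) (H.f x') (H.c y) (H.c y') _ _ _ H.label
      (fun S S' => H.ev_injective x y x' y' S S') (H.ev_local x y x' y') (P ω) [] [] h
  set T : Finset (List (Bool ⊕ E) × Option ι) :=
    Finset.univ.image fun p : (ι → Bool) × (ι → Bool) => rec p.1 p.2 with hT
  have hTcard : T.card ≤ 4 * 4 ^ B * (4 * Fintype.card E) ^ q * (Fintype.card ι + 1) := by
    have hsub : T ⊆ boundedLists E B q ×ˢ Finset.univ := by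
      intro r hr
      simp only [hT, Finset.mem_image, Finset.mem_univ, true_and] at hr
      obtain ⟨p, rfl⟩ := hr
      have h1 := Protocol.record_countP_isLeft br (H.f p.1) (H.c p.2) (H.ev p.1 p.2) H.label
        (P ω) [] []
      have h2 := Protocol.record_countP_isRight br (H.f p.1) (H.c p.2) (H.ev p.1 p.2) H.label
        (P ω) [] []
      have h3 := hω p.1 p.2
      simp only [Protocol.exec] at h3
      simp only [List.length_nil] at h2
      refine Finset.mem_product.2 ⟨mem_boundedLists B q _ ?_ ?_, Finset.mem_univ _⟩
      · simp only [hrec]; omega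
      · simp only [hrec]; omega
    calc T.card ≤ (boundedLists E B q ×ˢ (Finset.univ : Finset (Option ι))).card :=
          Finset.card_le_card hsub
      _ = (boundedLists E B q).card * (Fintype.card ι + 1) := by
          rw [Finset.card_product, Finset.card_univ, Fintype.card_option]
      _ ≤ _ := Nat.mul_le_mul_right _ (card_boundedLists_le B q)
  have hTpos : 0 < T.card := by
    rw [Finset.card_pos, hT]
    exact Finset.univ_nonempty.image _
  set X : List (Bool ⊕ E) × Option ι → (ι → Bool) → ℝ := fun r x =>
    if ∃ y, rec x y = r then 1 else 0 with hX
  set Y : List (Bool ⊕ E) × Option ι → (ι → Bool) → ℝ := fun r y =>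
    if ∃ x, rec x y = r then 1 else 0 with hY
  -- This is the rectangle property: a row and a column that both occur with record r also meet in
  -- it.
  have hXYr : ∀ r x y, X r x * Y r y = if rec x y = r then 1 else 0 := by
    intro r x y
    by_cases h : rec x y = r
    · have h1 : ∃ y, rec x y = r := ⟨y, h⟩
      have h2 : ∃ x, rec x y = r := ⟨x, h⟩
      simp only [hX, hY, if_pos h, if_pos h1, if_pos h2, mul_one]
    · have h1 : ¬ ((∃ y, rec x y = r) ∧ ∃ x, rec x y = r) := by
        rintro ⟨⟨y', hy'⟩, x', hx'⟩
        exact h ((hrect x y' x' y (hy'.trans hx'.symm)).trans hy')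
      rw [if_neg h]
      simp only [hX, hY]
      split_ifs with h3 h4
      · exact absurd ⟨h3, h4⟩ h1
      all_goals simp
  have hXY : ∀ x y, ∑ r ∈ T, X r x * Y r y = 1 := by
    intro x y
    have hm : rec x y ∈ T := Finset.mem_image.2 ⟨(x, y), Finset.mem_univ _, rfl⟩
    simp only [hXYr, Finset.sum_ite_eq, hm, if_true]
  have h01 : ∀ (p : Prop) [Decidable p], (0 : ℝ) ≤ (if p then 1 else 0) ∧ (if p then 1 else 0 : ℝ) ≤ 1 := by
    intro p _; split_ifs <;> simp
  have main := card_le_log_of_label T X Y (fun r x => by simp only [hX]; exact (h01 _).1)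
    (fun r x => by simp only [hX]; exact (h01 _).2) (fun r x => by simp only [hY]; exact (h01 _).1)
    (fun r x => by simp only [hY]; exact (h01 _).2) hXY Prod.snd ?_
  · refine main.trans ?_
    have := Real.log_le_log (by exact_mod_cast hTpos)
      (show (T.card : ℝ) ≤ ((4 * 4 ^ B * (4 * Fintype.card E) ^ q * (Fintype.card ι + 1) : ℕ) : ℝ)
        by exact_mod_cast hTcard)
    linarith
  -- Summing over the classes turns the label weight into the success frequency over all samples (i,
  -- D, u, v).
  have hsum : ∑ i, ∑ D, ∑ r ∈ T, (if r.2 = some i then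
      maskMean (X r) D i true * maskMean (Y r) (flipBits D) i true else 0)
      = (∑ s, if (rec (xs s) (ys s)).2 = some s.1 then (1 : ℝ) else 0)
        / (2 ^ Fintype.card ι * 2 ^ Fintype.card ι) := by
    simp only [Fintype.sum_prod_type, Finset.sum_div]
    refine Finset.sum_congr rfl fun i _ => Finset.sum_congr rfl fun D _ => ?_
    have e : ∀ r, (if r.2 = some i then
        maskMean (X r) D i true * maskMean (Y r) (flipBits D) i true else 0)
        = ∑ u, ∑ v, (if rec (xs (i, D, u, v)) (ys (i, D, u, v)) = r then
          (if r.2 = some i then (1 : ℝ) else 0) else 0)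
          / (2 ^ Fintype.card ι * 2 ^ Fintype.card ι) := by
      intro r
      simp only [maskMean, div_mul_div_comm, Finset.sum_mul_sum, ← Finset.sum_div, hXYr, hxs, hys]
      by_cases h : r.2 = some i
      · simp only [h, if_true]
      · simp [h]
    simp only [e]
    rw [Finset.sum_comm]
    refine Finset.sum_congr rfl fun u _ => ?_
    rw [Finset.sum_comm]
    refine Finset.sum_congr rfl fun v _ => ?_
    have hm : rec (xs (i, D, u, v)) (ys (i, D, u, v)) ∈ T :=
      Finset.mem_image.2 ⟨(_, _), Finset.mem_univ _, rfl⟩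
    rw [← Finset.sum_div, Finset.sum_ite_eq, if_pos hm]
  rw [hsum, le_div_iff₀ (by positivity)]
  have hgood : ∀ s, (1 : ℝ) - (if s ∈ (Finset.univ.filter fun s =>
      ¬ IsOptimalContract (H.f (xs s)) (H.c (ys s))
        ((P ω).exec br (H.f (xs s)) (H.c (ys s))).contract) then 1 else 0)
      ≤ if (rec (xs s) (ys s)).2 = some s.1 then (1 : ℝ) else 0 := by
    intro s
    by_cases h : IsOptimalContract (H.f (xs s)) (H.c (ys s))
        ((P ω).exec br (H.f (xs s)) (H.c (ys s))).contract
    · have h2 : (rec (xs s) (ys s)).2 = some s.1 := by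
        simp only [hrec, Protocol.record_snd]
        exact H.label_eq s.1 _ _ (by simp [hxs]) (by simp [hys]) (hmeet s) _ h
      simp [h, h2]
    · have := (h01 ((rec (xs s) (ys s)).2 = some s.1)).1
      simpa [h] using this
  have h5 := Finset.sum_le_sum fun s (_ : s ∈ Finset.univ) => hgood s
  refine le_trans ?_ h5
  rw [Finset.sum_sub_distrib, Finset.sum_ite_mem, Finset.univ_inter]
  simp only [Finset.sum_const, nsmul_eq_mul, mul_one, Finset.card_univ]
  have h6 : (3 : ℝ) * (Finset.univ.filter fun s =>
      ¬ IsOptimalContract (H.f (xs s)) (H.c (ys s))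
        ((P ω).exec br (H.f (xs s)) (H.c (ys s))).contract).card
      ≤ Fintype.card (ι × (ι → Bool) × (ι → Bool) × (ι → Bool)) := by
    simp only [Set.mem_ofPred_eq] at hcard
    exact_mod_cast hcard
  have h7 : (Fintype.card (ι × (ι → Bool) × (ι → Bool) × (ι → Bool)) : ℝ)
      = Fintype.card ι * (2 ^ Fintype.card ι * (2 ^ Fintype.card ι * 2 ^ Fintype.card ι)) := by
    simp
  rw [h7] at h6 ⊢
  linarith

/-! ### Lines in convex position whose breakpoints have nearly equal value. -/

/-- The breakpoint between two consecutive lines `d k - t * f k`. -/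
noncomputable def breakpoint (f d : ℕ → ℝ) (k : ℕ) : ℝ := (d k - d (k + 1)) / (f k - f (k + 1))

/-- For lines in convex position, a line that beats its two neighbours beats all lines. -/
theorem envelope_of_neighbours (M : ℕ) (f d : ℕ → ℝ) (hf : ∀ k < M, f (k + 1) < f k)
    (hτ : ∀ k, k + 1 < M → breakpoint f d k < breakpoint f d (k + 1)) (t : ℝ) (k : ℕ)
    (h1 : ∀ j, j + 1 = k → d j - t * f j < d k - t * f k)
    (h2 : k < M → d (k + 1) - t * f (k + 1) ≤ d k - t * f k) (hk : k ≤ M) :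
    (∀ l, l < k → d l - t * f l < d k - t * f k) ∧
      ∀ l, k ≤ l → l ≤ M → d l - t * f l ≤ d k - t * f k := by
  have hle : ∀ j < M, d (j + 1) - t * f (j + 1) ≤ d j - t * f j ↔ t ≤ breakpoint f d j := by
    intro j hj
    have := hf j hj
    rw [breakpoint, le_div_iff₀ (by linarith)]
    constructor <;> intro h <;> linarith
  have hmono : ∀ i j, i ≤ j → j < M → breakpoint f d i ≤ breakpoint f d j := by
    intro i j hij
    induction j, hij using Nat.le_induction with
    | base => intro _; exact le_rfl
    | succ j hij ih => intro h; exact (ih (by omega)).trans (hτ j h).le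
  constructor
  · intro l hl
    have hstep : ∀ j, l ≤ j → j < k → d l - t * f l < d (j + 1) - t * f (j + 1) := by
      have hs : ∀ j < k, d j - t * f j < d (j + 1) - t * f (j + 1) := by
        intro j hj
        by_contra hcon
        have h3 := (hle j (by omega)).1 (not_lt.1 hcon)
        have h4 := hmono j (k - 1) (by omega) (by omega)
        have h5 := (hle (k - 1) (by omega)).2 (h3.trans h4)
        have h6 := h1 (k - 1) (by omega)
        rw [Nat.sub_add_cancel (by omega)] at h5
        linarith
      intro j hlj
      induction j, hlj using Nat.le_induction with
      | base => exact hs l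
      | succ j hlj ih => intro h; exact (ih (by omega)).trans (hs _ h)
    have := hstep (k - 1) (by omega) (by omega)
    rwa [Nat.sub_add_cancel (by omega)] at this
  · intro l hl
    induction l, hl using Nat.le_induction with
    | base => intro _; exact le_rfl
    | succ l hl ih =>
      intro h
      refine le_trans ((hle l (by omega)).2 ?_) (ih (by omega))
      exact ((hle k (by omega)).1 (h2 (by omega))).trans (hmono k l hl (by omega))

/-- The parameters of a sequence of lines whose breakpoints all give nearly the same utility. -/
structure Curve where
  K : ℕ
  F : ℤ
  W : ℤ
  U : ℤ
  h : ℤ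
  K_pos : 1 ≤ K
  W_ge : 64 ≤ W
  W_le : 16 * K * W ≤ h
  F_ge : h ≤ F
  U_le : 16 * U ≤ h
  U_ge : 18 * F ^ 2 ≤ W ^ 2 * U

/-- The bit of `x` at an even index; the odd indices carry no bits. -/
def bitAt {K : ℕ} (x : Fin K → Bool) (k : ℕ) : Bool :=
  if h : k / 2 < K then k % 2 == 0 && x ⟨k / 2, h⟩ else false

/-- The bit as an integer. -/
def bitVal {K : ℕ} (x : Fin K → Bool) (k : ℕ) : ℤ := if bitAt x k then 1 else 0

theorem bitVal_cases {K : ℕ} (x : Fin K → Bool) (k : ℕ) : bitVal x k = 0 ∨ bitVal x k = 1 := by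
  unfold bitVal; split_ifs <;> simp

theorem bitVal_odd {K : ℕ} (x : Fin K → Bool) (k : ℕ) (hk : k % 2 = 1) : bitVal x k = 0 := by
  simp [bitVal, bitAt, hk]

theorem bitVal_of_le {K : ℕ} (x : Fin K → Bool) (k : ℕ) (hk : 2 * K ≤ k) : bitVal x k = 0 := by
  have : ¬ k / 2 < K := by omega
  simp [bitVal, bitAt, this]

theorem bitVal_two_mul {K : ℕ} (x : Fin K → Bool) (i : Fin K) :
    bitVal x (2 * i) = if x i then 1 else 0 := by
  simp [bitVal, bitAt]

namespace Curve

variable (C : Curve)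

/-- The unperturbed reward. -/
def phi (k : ℕ) : ℤ := if k < 2 * C.K then C.F - k * C.W else 0

/-- The unperturbed breakpoints, as multiples of `1 / W`. -/
def gap (k : ℕ) : ℤ := if k + 1 < 2 * C.K then C.W * C.U / C.phi k else C.U

/-- The unperturbed difference of reward and cost. -/
def diff (k : ℕ) : ℤ := ∑ l ∈ Finset.Ico k (2 * C.K), C.gap l

/-- The reward of the `k`-th set. -/
def reward (x : Fin C.K → Bool) (k : ℕ) : ℤ := C.phi k + 4 * bitVal x k

/-- The cost of the `k`-th set. -/
def cost (y : Fin C.K → Bool) (k : ℕ) : ℤ := C.phi k - C.diff k - 4 * bitVal y k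

theorem W_pos : 0 < C.W := by have := C.W_ge; omega

theorem W_mul_K_pos : C.W ≤ C.K * C.W := by
  have h1 := C.W_pos
  have h2 : (1 : ℤ) ≤ C.K := by exact_mod_cast C.K_pos
  nlinarith

theorem h_ge : 16 * C.W ≤ C.h := by
  have := C.W_le; have := C.W_mul_K_pos; linarith

theorem F_pos : 0 < C.F := by
  have := C.W_pos; have := C.h_ge; have := C.F_ge; linarith

theorem U_pos : 0 < C.U := by
  have h1 := C.U_ge
  have h2 := C.F_pos
  by_contra h
  have : C.W ^ 2 * C.U ≤ 0 := mul_nonpos_of_nonneg_of_nonpos (by positivity) (not_lt.1 h)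
  nlinarith [pow_pos h2 2]

theorem mul_W_le {k : ℕ} (hk : k < 2 * C.K) : 8 * (k * C.W) ≤ C.h := by
  have h1 : (k : ℤ) ≤ 2 * C.K := by exact_mod_cast hk.le
  have h2 := mul_le_mul_of_nonneg_right h1 C.W_pos.le
  have := C.W_le
  linarith

theorem phi_of_lt {k : ℕ} (hk : k < 2 * C.K) : C.phi k = C.F - k * C.W := if_pos hk

theorem phi_of_le {k : ℕ} (hk : 2 * C.K ≤ k) : C.phi k = 0 := if_neg (not_lt.2 hk)

theorem phi_le {k : ℕ} (hk : k < 2 * C.K) : C.phi k ≤ C.F := by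
  rw [C.phi_of_lt hk]
  have : 0 ≤ (k : ℤ) * C.W := mul_nonneg (by positivity) C.W_pos.le
  linarith

theorem phi_ge {k : ℕ} (hk : k < 2 * C.K) : 7 * C.F ≤ 8 * C.phi k := by
  rw [C.phi_of_lt hk]
  have := C.mul_W_le hk
  have := C.F_ge
  linarith

theorem phi_pos {k : ℕ} (hk : k < 2 * C.K) : 0 < C.phi k := by
  have := C.phi_ge hk; have := C.F_pos; omega

theorem phi_succ {k : ℕ} (hk : k + 1 < 2 * C.K) : C.phi (k + 1) = C.phi k - C.W := by
  rw [C.phi_of_lt hk, C.phi_of_lt (by omega)]; push_cast; ring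

theorem gap_mul_le {k : ℕ} (hk : k + 1 < 2 * C.K) : C.gap k * C.phi k ≤ C.W * C.U := by
  rw [gap, if_pos hk]
  exact Int.ediv_mul_le _ (C.phi_pos (by omega)).ne'

theorem lt_gap_mul {k : ℕ} (hk : k + 1 < 2 * C.K) : C.W * C.U < (C.gap k + 1) * C.phi k := by
  rw [gap, if_pos hk]
  exact Int.lt_ediv_add_one_mul_self _ (C.phi_pos (by omega))

theorem gap_last {k : ℕ} (hk : k + 1 = 2 * C.K) : C.gap k = C.U := by
  rw [gap, if_neg (by omega)]

/-- This is the purpose of `U_ge`: gap is about W * U / phi ≥ W * U / F, so gap * W is about 18F,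
less at most W for rounding. It controls how fast the gaps grow. -/
theorem lt_gap_mul_W {k : ℕ} (hk : k + 1 < 2 * C.K) : 17 * C.F < C.gap k * C.W := by
  have h1 := C.lt_gap_mul hk
  have h2 := C.phi_pos (k := k) (by omega)
  have h3 := C.phi_le (k := k) (by omega)
  have h4 := C.U_ge
  have h5 := C.W_pos
  have h6 : 18 * C.F * C.phi k < (C.gap k + 1) * C.W * C.phi k := by
    have h7 := mul_lt_mul_of_pos_left h1 h5
    have h8 := mul_le_mul_of_nonneg_left h3 C.F_pos.le
    nlinarith
  have h7 := lt_of_mul_lt_mul_right h6 h2.le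
  have := C.h_ge
  have := C.F_ge
  linarith

theorem gap_ge {k : ℕ} (hk : k + 1 < 2 * C.K) : 8 ≤ C.gap k := by
  have h1 := C.lt_gap_mul_W hk
  have h2 := C.W_pos
  have := C.h_ge
  have := C.F_ge
  by_contra h
  have : C.gap k * C.W ≤ 8 * C.W := mul_le_mul_of_nonneg_right (by omega) h2.le
  linarith

theorem gap_le {k : ℕ} (hk : k + 1 < 2 * C.K) : 14 * C.gap k ≤ C.W := by
  have h1 := C.gap_mul_le hk
  have h2 := C.phi_ge (k := k) (by omega)
  have h3 := C.phi_pos (k := k) (by omega)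
  have h4 : 14 * C.U ≤ C.phi k := by
    have := C.U_le; have := C.F_ge; linarith
  have h5 := mul_le_mul_of_nonneg_left h4 C.W_pos.le
  have : 14 * C.gap k * C.phi k ≤ C.W * C.phi k := by linarith
  exact le_of_mul_le_mul_right this h3

/-- Lowering phi by W raises W * U / phi by about gap * W / phi > 17, and the floor costs at most 1.
The margin 16 = 8 + 8 covers the largest shifts of two neighbouring breakpoints by bits. -/
theorem gap_succ {k : ℕ} (hk : k + 2 < 2 * C.K) : C.gap k + 16 < C.gap (k + 1) := by
  have h1 := C.gap_mul_le (k := k) (by omega)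
  have h2 := C.lt_gap_mul (k := k + 1) (by omega)
  have h3 := C.lt_gap_mul_W (k := k) (by omega)
  have h4 := C.phi_succ (k := k) (by omega)
  have h5 := C.phi_pos (k := k + 1) (by omega)
  have h6 := C.phi_le (k := k + 1) (by omega)
  have h7 : 17 * C.phi (k + 1) < (C.gap (k + 1) + 1 - C.gap k) * C.phi (k + 1) := by
    have : C.phi k = C.phi (k + 1) + C.W := by omega
    rw [this] at h1
    linarith
  have := lt_of_mul_lt_mul_right h7 h5.le
  omega

theorem gap_penultimate {k : ℕ} (hk : k + 2 = 2 * C.K) :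
    (C.gap k + 8) * C.phi (k + 1) < C.W * C.U := by
  have h1 := C.gap_mul_le (k := k) (by omega)
  have h3 := C.lt_gap_mul_W (k := k) (by omega)
  have h4 := C.phi_succ (k := k) (by omega)
  have h6 := C.phi_le (k := k + 1) (by omega)
  have : C.phi k = C.phi (k + 1) + C.W := by omega
  rw [this] at h1
  have := C.F_pos
  linarith

theorem diff_succ {k : ℕ} (hk : k < 2 * C.K) : C.diff k = C.gap k + C.diff (k + 1) :=
  Finset.sum_eq_sum_Ico_succ_bot hk _

theorem diff_of_le {k : ℕ} (hk : 2 * C.K ≤ k) : C.diff k = 0 := by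
  rw [diff, Finset.Ico_eq_empty_of_le hk, Finset.sum_empty]

theorem gap_nonneg (k : ℕ) : 0 ≤ C.gap k := by
  by_cases hk : k + 1 < 2 * C.K
  · have := C.gap_ge hk; omega
  · rw [gap, if_neg hk]; exact C.U_pos.le

theorem diff_nonneg (k : ℕ) : 0 ≤ C.diff k := Finset.sum_nonneg fun _ _ => C.gap_nonneg _

theorem diff_le (k : ℕ) : 4 * C.diff k ≤ C.h := by
  have h1 : ∀ l, C.gap l ≤ C.W + if l + 1 < 2 * C.K then 0 else C.U := by
    intro l
    have := C.W_pos
    split_ifs with h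
    · have := C.gap_le h; have := C.gap_nonneg l; omega
    · rw [gap, if_neg h]; omega
  have h2 : C.diff k ≤ C.diff 0 :=
    Finset.sum_le_sum_of_subset_of_nonneg (Finset.Ico_subset_Ico_left (Nat.zero_le _))
      fun _ _ _ => C.gap_nonneg _
  have h3 : C.diff 0 ≤ 2 * C.K * C.W + C.U := by
    obtain ⟨m, hm⟩ : ∃ m, 2 * C.K = m + 1 := ⟨2 * C.K - 1, by have := C.K_pos; omega⟩
    have hm' : (2 * C.K : ℤ) = m + 1 := by exact_mod_cast hm
    rw [diff, ← Finset.range_eq_Ico, hm, Finset.sum_range_succ, hm']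
    have h4 : ∑ l ∈ Finset.range m, C.gap l ≤ ∑ l ∈ Finset.range m, C.W := by
      refine Finset.sum_le_sum fun l hl => ?_
      have := h1 l
      rwa [if_pos (by have := Finset.mem_range.1 hl; omega), add_zero] at this
    rw [Finset.sum_const, Finset.card_range, nsmul_eq_mul] at h4
    have h5 := C.gap_last (k := m) (by omega)
    have := C.W_pos
    linarith
  have := C.W_le
  have := C.U_le
  have := C.h_ge
  have := C.W_pos
  linarith

/-- The reward as a sequence of reals. -/
noncomputable def rewardR (x : Fin C.K → Bool) (k : ℕ) : ℝ := C.reward x k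

/-- The difference of reward and cost as a sequence of reals. -/
noncomputable def surplus (x y : Fin C.K → Bool) (k : ℕ) : ℝ := C.reward x k - C.cost y k

theorem rewardR_sub {k : ℕ} (x : Fin C.K → Bool) (hk : k + 1 < 2 * C.K) :
    C.rewardR x k - C.rewardR x (k + 1) = C.W + 4 * bitVal x k - 4 * bitVal x (k + 1) := by
  simp only [rewardR, reward, C.phi_succ hk]; push_cast; ring

theorem surplus_sub {k : ℕ} (x y : Fin C.K → Bool) (hk : k < 2 * C.K) :
    C.surplus x y k - C.surplus x y (k + 1)
      = C.gap k + 4 * (bitVal x k + bitVal y k) - 4 * (bitVal x (k + 1) + bitVal y (k + 1)) := by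
  simp only [surplus, reward, cost, C.diff_succ hk]; push_cast; ring

theorem rewardR_last {k : ℕ} (x : Fin C.K → Bool) (hk : k + 1 = 2 * C.K) :
    C.rewardR x k = C.phi k := by
  rw [rewardR, reward, bitVal_odd x k (by omega)]; simp

theorem reward_of_le {k : ℕ} (x : Fin C.K → Bool) (hk : 2 * C.K ≤ k) : C.reward x k = 0 := by
  rw [reward, bitVal_of_le x k hk, C.phi_of_le hk]; simp

theorem cost_of_le {k : ℕ} (y : Fin C.K → Bool) (hk : 2 * C.K ≤ k) : C.cost y k = 0 := by
  rw [cost, bitVal_of_le y k hk, C.phi_of_le hk, C.diff_of_le hk]; simp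

theorem rewardR_lt {k : ℕ} (x : Fin C.K → Bool) (hk : k < 2 * C.K) :
    C.rewardR x (k + 1) < C.rewardR x k := by
  by_cases h : k + 1 < 2 * C.K
  · have h1 := C.rewardR_sub x h
    have h2 : (64 : ℝ) ≤ C.W := by exact_mod_cast C.W_ge
    rcases bitVal_cases x k with e | e <;> rcases bitVal_cases x (k + 1) with e' | e' <;>
      rw [e, e'] at h1 <;> push_cast at h1 <;> linarith
  · have h1 := C.rewardR_last x (show k + 1 = 2 * C.K by omega)
    have h2 : C.rewardR x (k + 1) = 0 := by
      rw [rewardR, C.reward_of_le x (by omega)]; simp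
    rw [h1, h2]
    exact_mod_cast C.phi_pos hk

theorem rewardR_strictAnti (x : Fin C.K → Bool) {k l : ℕ} (hkl : k < l) (hl : l ≤ 2 * C.K) :
    C.rewardR x l < C.rewardR x k := by
  induction l, Nat.succ_le_of_lt hkl using Nat.le_induction with
  | base => exact C.rewardR_lt x (by omega)
  | succ l h ih => exact (C.rewardR_lt x (by omega)).trans (ih (by omega) (by omega))

/-- The breakpoints of the perturbed lines. -/
noncomputable def tau (x y : Fin C.K → Bool) (k : ℕ) : ℝ :=
  breakpoint (C.rewardR x) (C.surplus x y) k

theorem tau_even {k : ℕ} (x y : Fin C.K → Bool) (hk : k + 1 < 2 * C.K) (hev : k % 2 = 0) :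
    C.tau x y k = (C.gap k + 4 * (bitVal x k + bitVal y k)) / (C.W + 4 * bitVal x k) := by
  rw [tau, breakpoint, C.rewardR_sub x hk, C.surplus_sub x y (by omega),
    bitVal_odd x (k + 1) (by omega), bitVal_odd y (k + 1) (by omega)]
  simp

theorem tau_odd {k : ℕ} (x y : Fin C.K → Bool) (hk : k + 1 < 2 * C.K) (hodd : k % 2 = 1) :
    C.tau x y k = (C.gap k - 4 * (bitVal x (k + 1) + bitVal y (k + 1)))
      / (C.W - 4 * bitVal x (k + 1)) := by
  rw [tau, breakpoint, C.rewardR_sub x hk, C.surplus_sub x y (by omega),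
    bitVal_odd x k (by omega), bitVal_odd y k (by omega)]
  simp

theorem tau_last {k : ℕ} (x y : Fin C.K → Bool) (hk : k + 1 = 2 * C.K) :
    C.tau x y k = C.U / C.phi k := by
  rw [tau, breakpoint, C.surplus_sub x y (by omega), C.gap_last hk, C.rewardR_last x hk, rewardR,
    C.reward_of_le x (by omega), bitVal_odd x k (by omega), bitVal_odd y k (by omega),
    bitVal_of_le x (k + 1) (by omega), bitVal_of_le y (k + 1) (by omega)]
  simp

theorem real_bounds {k : ℕ} (hk : k + 1 < 2 * C.K) :
    (64 : ℝ) ≤ C.W ∧ (8 : ℝ) ≤ C.gap k ∧ 14 * (C.gap k : ℝ) ≤ C.W := by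
  refine ⟨by exact_mod_cast C.W_ge, by exact_mod_cast C.gap_ge hk, by exact_mod_cast C.gap_le hk⟩

theorem tau_le {k : ℕ} (x y : Fin C.K → Bool) (hk : k + 1 < 2 * C.K) :
    C.tau x y k ≤ (C.gap k + 8) / C.W := by
  obtain ⟨hW, hT, hTW⟩ := C.real_bounds hk
  rcases Nat.mod_two_eq_zero_or_one k with h | h
  · rw [C.tau_even x y hk h]
    rcases bitVal_cases x k with e | e <;> rcases bitVal_cases y k with e' | e' <;>
      rw [e, e'] <;> push_cast <;>
      rw [div_le_div_iff₀ (by linarith) (by linarith)] <;> nlinarith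
  · rw [C.tau_odd x y hk h]
    rcases bitVal_cases x (k + 1) with e | e <;> rcases bitVal_cases y (k + 1) with e' | e' <;>
      rw [e, e'] <;> push_cast <;>
      rw [div_le_div_iff₀ (by linarith) (by linarith)] <;> nlinarith

theorem le_tau {k : ℕ} (x y : Fin C.K → Bool) (hk : k + 1 < 2 * C.K) :
    (C.gap k - 8) / C.W ≤ C.tau x y k := by
  obtain ⟨hW, hT, hTW⟩ := C.real_bounds hk
  rcases Nat.mod_two_eq_zero_or_one k with h | h
  · rw [C.tau_even x y hk h]
    rcases bitVal_cases x k with e | e <;> rcases bitVal_cases y k with e' | e' <;>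
      rw [e, e'] <;> push_cast <;>
      rw [div_le_div_iff₀ (by linarith) (by linarith)] <;> nlinarith
  · rw [C.tau_odd x y hk h]
    rcases bitVal_cases x (k + 1) with e | e <;> rcases bitVal_cases y (k + 1) with e' | e' <;>
      rw [e, e'] <;> push_cast <;>
      rw [div_le_div_iff₀ (by linarith) (by linarith)] <;> nlinarith

/-- Convex position survives every choice of bits, so optimality remains a comparison with
neighbours. The last breakpoint has denominator phi instead of W and is treated apart. -/
theorem tau_lt_tau_succ {k : ℕ} (x y : Fin C.K → Bool) (hk : k + 1 < 2 * C.K) :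
    C.tau x y k < C.tau x y (k + 1) := by
  have hW : (0 : ℝ) < C.W := by exact_mod_cast C.W_pos
  refine (C.tau_le x y hk).trans_lt ?_
  by_cases h : k + 2 < 2 * C.K
  · refine lt_of_lt_of_le ?_ (C.le_tau x y h)
    rw [div_lt_div_iff_of_pos_right hW]
    have : (C.gap k : ℝ) + 16 < C.gap (k + 1) := by exact_mod_cast C.gap_succ h
    linarith
  · rw [C.tau_last x y (show k + 1 + 1 = 2 * C.K by omega),
      div_lt_div_iff₀ hW (by exact_mod_cast C.phi_pos hk), mul_comm (C.U : ℝ)]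
    exact_mod_cast C.gap_penultimate (show k + 2 = 2 * C.K by omega)

/-- The utility at a breakpoint that does not carry two bits. -/
theorem tau_mul_reward_le {k : ℕ} (x y : Fin C.K → Bool) (hk : k < 2 * C.K)
    (hxy : ¬ (bitVal x k = 1 ∧ bitVal y k = 1)) :
    C.tau x y k * C.rewardR x k ≤ C.U + 4 * C.F / C.W := by
  have hW : (64 : ℝ) ≤ C.W := by exact_mod_cast C.W_ge
  have hφ : (0 : ℝ) < C.phi k := by exact_mod_cast C.phi_pos hk
  have hφF : (C.phi k : ℝ) ≤ C.F := by exact_mod_cast C.phi_le hk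
  have hF : (0 : ℝ) < C.F := by exact_mod_cast C.F_pos
  by_cases h1 : k + 1 < 2 * C.K
  swap
  · have h2 : k + 1 = 2 * C.K := by omega
    rw [C.tau_last x y h2, C.rewardR_last x h2, div_mul_cancel₀ _ hφ.ne']
    have : (0 : ℝ) ≤ 4 * C.F / C.W := by positivity
    linarith
  obtain ⟨-, hT, hTW⟩ := C.real_bounds h1
  have hm : (C.gap k : ℝ) * C.phi k ≤ C.W * C.U := by exact_mod_cast C.gap_mul_le h1
  have hWφ : (C.W : ℝ) ≤ C.phi k := by
    have := C.phi_ge hk; have := C.h_ge; have := C.F_ge; have := C.W_pos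
    exact_mod_cast (by omega : C.W ≤ C.phi k)
  -- One bit of either party counts as s = 4. For Alice's bit the extra reward is outweighed by the
  -- larger denominator W + 4, because W ≤ phi.
  have hb : ∀ s : ℝ, s ≤ 4 → (C.gap k + s) * C.phi k / C.W ≤ C.U + 4 * C.F / C.W := by
    intro s hs
    rw [add_div' _ _ _ (by linarith), div_le_div_iff_of_pos_right (by linarith)]
    nlinarith
  rw [rewardR, reward]
  push_cast
  rcases Nat.mod_two_eq_zero_or_one k with h | h
  · rw [C.tau_even x y h1 h]
    rcases bitVal_cases x k with e | e <;> rcases bitVal_cases y k with e' | e' <;>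
      rw [e, e'] <;> push_cast
    · refine le_trans (le_of_eq ?_) (hb 0 (by norm_num)); ring
    · refine le_trans (le_of_eq ?_) (hb 4 le_rfl); ring
    · refine le_trans ?_ (hb 4 le_rfl)
      rw [div_mul_eq_mul_div, div_le_div_iff₀ (by linarith) (by linarith)]
      nlinarith
    · exact absurd ⟨e, e'⟩ hxy
  · rw [C.tau_odd x y h1 h, bitVal_odd x k h]
    refine le_trans ?_ (hb 0 (by norm_num))
    have : ((C.gap k : ℝ) - 4 * (bitVal x (k + 1) + bitVal y (k + 1))) / (C.W - 4 * bitVal x (k + 1))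
        ≤ C.gap k / C.W := by
      rcases bitVal_cases x (k + 1) with e | e <;> rcases bitVal_cases y (k + 1) with e' | e' <;>
        rw [e, e'] <;> push_cast <;>
        rw [div_le_div_iff₀ (by linarith) (by linarith)] <;> nlinarith
    calc _ ≤ C.gap k / C.W * (C.phi k : ℝ) := by
          simp only [Int.cast_zero, mul_zero, add_zero]
          exact mul_le_mul_of_nonneg_right this hφ.le
      _ = _ := by ring

/-- The breakpoint of the `2i`-th line when both parties hold `i`. -/
noncomputable def peak (i : ℕ) : ℝ := (C.gap (2 * i) + 8) / (C.W + 4)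

theorem tau_eq_peak (x y : Fin C.K → Bool) (i : Fin C.K) (hx : x i = true) (hy : y i = true) :
    C.tau x y (2 * i) = C.peak i := by
  rw [C.tau_even x y (by omega) (by omega), bitVal_two_mul, bitVal_two_mul, hx, hy, peak]
  norm_num

/-- Of the 8 added to the gap, one unit repairs the floor. The other seven give 7 * phi ≥ 49F/8,
which beats the 4F + F/4 + F/4 left after clearing the denominators W and W + 4. -/
theorem peak_mul_reward_gt (x : Fin C.K → Bool) (i : Fin C.K) (hx : x i = true) :
    C.U + 4 * C.F / C.W < C.peak i * C.rewardR x (2 * i) := by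
  have hk : 2 * (i : ℕ) + 1 < 2 * C.K := by omega
  have hW : (64 : ℝ) ≤ C.W := by exact_mod_cast C.W_ge
  have hφ : (0 : ℝ) < C.phi (2 * i) := by exact_mod_cast C.phi_pos (by omega)
  have hφF : 7 * (C.F : ℝ) ≤ 8 * C.phi (2 * i) := by exact_mod_cast C.phi_ge (by omega)
  have hF : (0 : ℝ) < C.F := by exact_mod_cast C.F_pos
  have hU : 16 * (C.U : ℝ) ≤ C.F := by exact_mod_cast C.U_le.trans C.F_ge
  have hm : (C.W : ℝ) * C.U < (C.gap (2 * i) + 1) * C.phi (2 * i) := by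
    exact_mod_cast C.lt_gap_mul hk
  have hT : (8 : ℝ) ≤ C.gap (2 * i) := by exact_mod_cast C.gap_ge hk
  rw [rewardR, reward, bitVal_two_mul, hx, peak, if_pos rfl]
  push_cast
  have hFW : 64 * ((C.F : ℝ) / C.W) ≤ C.F := by
    rw [← mul_div_assoc, div_le_iff₀ (by linarith)]; nlinarith
  have e1 : 4 * (C.F : ℝ) / C.W * C.W = 4 * C.F := div_mul_cancel₀ _ (by linarith)
  have e2 : 4 * (C.F : ℝ) / C.W = 4 * (C.F / C.W) := by ring
  rw [div_mul_eq_mul_div, lt_div_iff₀ (by linarith)]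
  have e3 : ((C.U : ℝ) + 4 * C.F / C.W) * (C.W + 4)
      = C.W * C.U + 4 * C.U + 4 * C.F + 16 * (C.F / C.W) := by
    rw [add_mul, mul_add (4 * (C.F : ℝ) / C.W), e1, e2]; ring
  rw [e3]
  nlinarith

theorem peak_mem (i : Fin C.K) : 0 ≤ C.peak i ∧ C.peak i ≤ 1 := by
  obtain ⟨hW, hT, hTW⟩ := C.real_bounds (k := 2 * i) (by omega)
  constructor
  · exact div_nonneg (by linarith) (by linarith)
  · rw [peak, div_le_one (by linarith)]; linarith

theorem gap_strictMono {k l : ℕ} (hkl : k < l) (hl : l + 1 < 2 * C.K) : C.gap k < C.gap l := by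
  induction l, Nat.succ_le_of_lt hkl using Nat.le_induction with
  | base => have := C.gap_succ (k := k) (by omega); show C.gap k < C.gap (k + 1); omega
  | succ l h ih =>
    have := C.gap_succ (k := l) (by omega)
    have := ih (by omega) (by omega)
    omega

theorem peak_injective {i j : Fin C.K} (h : C.peak i = C.peak j) : i = j := by
  have hW : (0 : ℝ) < C.W + 4 := by
    have : (0 : ℝ) < C.W := by exact_mod_cast C.W_pos
    linarith
  rw [peak, peak, div_left_inj' hW.ne', add_left_inj, Int.cast_inj] at h
  by_contra hij
  rcases lt_or_gt_of_ne (Fin.val_ne_of_ne hij) with h1 | h1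
  · exact absurd h (C.gap_strictMono (by omega) (by omega)).ne
  · exact absurd h (C.gap_strictMono (by omega) (by omega)).ne'

end Curve

/-! ### Supermodular instances realizing the lines. -/

/-- An enumeration of `M` sets of the same positive size `m`. The empty set has rank `M`, and all
other sets have larger ranks. -/
structure Ranking (n M : ℕ) where
  m : ℕ
  m_pos : 1 ≤ m
  m_le : m ≤ n
  rank : Finset (Fin n) → ℕ
  exists_rank_eq : ∀ k ≤ M, ∃ S, rank S = k
  rank_injective : ∀ S T, rank S = rank T → rank S ≤ M → S = T
  card_eq : ∀ S, rank S < M → S.card = m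
  rank_empty : rank ∅ = M

theorem exists_ranking (n m M : ℕ) (hm : 1 ≤ m) (hmn : m ≤ n) (hM : M ≤ n.choose m) :
    ∃ R : Ranking n M, R.m = m := by
  classical
  set L := Finset.powersetCard m (Finset.univ : Finset (Fin n)) with hL
  have hcard : L.card = n.choose m := by simp [hL]
  have hmem : ∀ S, S ∈ L ↔ S.card = m := by simp [hL]
  have hne : ∀ S ∈ L, S ≠ ∅ := by
    rintro S hS rfl
    rw [hmem, Finset.card_empty] at hS
    omega
  let rank : Finset (Fin n) → ℕ := fun S => if S = ∅ then M else
    if h : S ∈ L then (if (L.equivFin ⟨S, h⟩ : ℕ) < M then L.equivFin ⟨S, h⟩ else M + 1) else M + 1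
  have hlt : ∀ S, rank S < M → ∃ h : S ∈ L, rank S = L.equivFin ⟨S, h⟩ := by
    intro S hS
    simp only [rank] at hS ⊢
    split_ifs at hS ⊢ with h1 h2 h3
    · omega
    · exact ⟨h2, rfl⟩
    · omega
    · omega
  have heq : ∀ S, rank S = M → S = ∅ := by
    intro S hS
    simp only [rank] at hS
    split_ifs at hS with h1 h2 h3
    · exact h1
    · omega
    · omega
    · omega
  refine ⟨⟨m, hm, hmn, rank, ?_, ?_, ?_, by simp [rank]⟩, rfl⟩
  · intro k hk
    rcases hk.eq_or_lt with rfl | hk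
    · exact ⟨∅, by simp [rank]⟩
    · let i : Fin L.card := ⟨k, by omega⟩
      refine ⟨(L.equivFin.symm i).1, ?_⟩
      have h1 := (L.equivFin.symm i).2
      simp only [rank]
      rw [if_neg (hne _ h1), dif_pos h1]
      simp [i, hk]
  · intro S T hST hS
    rcases hS.eq_or_lt with h | h
    · rw [heq S h, heq T (hST ▸ h)]
    · obtain ⟨h1, e1⟩ := hlt S h
      obtain ⟨h2, e2⟩ := hlt T (hST ▸ h)
      have h3 : L.equivFin ⟨S, h1⟩ = L.equivFin ⟨T, h2⟩ := Fin.ext (by rw [← e1, ← e2, hST])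
      exact congrArg Subtype.val (L.equivFin.injective h3)
  · intro S hS
    obtain ⟨h1, -⟩ := hlt S hS
    exact (hmem S).1 h1

/-- A strongly convex function of the cardinality stays admissible under small perturbations. -/
theorem isAdmissible_of_perturbation {n b : ℕ} (h : ℤ) (p : Finset (Fin n) → ℤ)
    (hp : ∀ S, 2 * |p S| ≤ h) (hp0 : p ∅ = 0) (hb : 2 * (h * n ^ 2) + h ≤ 2 * 2 ^ b) :
    IsAdmissible b (fun S => ((h * S.card ^ 2 + p S : ℤ) : ℝ) / 2 ^ b) := by
  have hh : 0 ≤ h := le_trans (by positivity) (hp ∅)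
  have hp' : ∀ S, -h ≤ 2 * p S ∧ 2 * p S ≤ h := fun S =>
    ⟨by have := hp S; have := neg_abs_le (p S); linarith,
      by have := hp S; have := le_abs_self (p S); linarith⟩
  have hpos : (0 : ℝ) < 2 ^ b := by positivity
  refine ⟨?_, ?_, ?_⟩
  · intro S T hST
    simp only
    rw [div_le_div_iff_of_pos_right hpos]
    norm_cast
    rcases eq_or_ne S T with rfl | hne
    · exact le_rfl
    · have h1 : S.card < T.card := Finset.card_lt_card (hST.ssubset_of_ne hne)
      have h2 : (S.card : ℤ) + 1 ≤ T.card := by exact_mod_cast h1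
      have h3 : (S.card : ℤ) ^ 2 + 1 ≤ T.card ^ 2 := by nlinarith
      have h4 := mul_le_mul_of_nonneg_left h3 hh
      have := hp' S
      have := hp' T
      push_cast
      linarith
  · intro S T hST i hi
    rcases eq_or_ne S T with rfl | hne
    · exact le_rfl
    · have h1 : S.card < T.card := Finset.card_lt_card (hST.ssubset_of_ne hne)
      have h2 : (S.card : ℤ) + 1 ≤ T.card := by exact_mod_cast h1
      have h4 := mul_le_mul_of_nonneg_left h2 hh
      have hS := hp' S
      have hT := hp' T
      have hS' := hp' (insert i S)
      have hT' := hp' (insert i T)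
      simp only [marginal, Finset.card_insert_of_notMem hi,
        Finset.card_insert_of_notMem (fun h => hi (hST h))]
      -- For S ⊂ T the marginals of h * |S|^2 differ by at least 2h, which absorbs four
      -- perturbations of size h/2.
      have key : (h * ((S.card + 1 : ℕ) : ℤ) ^ 2 + p (insert i S)) - (h * (S.card : ℤ) ^ 2 + p S)
          ≤ (h * ((T.card + 1 : ℕ) : ℤ) ^ 2 + p (insert i T)) - (h * (T.card : ℤ) ^ 2 + p T) := by
        push_cast
        linarith
      have key' := (Int.cast_le (R := ℝ)).2 key
      have := div_le_div_of_nonneg_right key' hpos.le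
      rw [Int.cast_sub, Int.cast_sub, sub_div, sub_div] at this
      linarith
  · intro S
    have h0 : 0 ≤ h * (S.card : ℤ) ^ 2 + p S := by
      rcases S.eq_empty_or_nonempty with rfl | hS
      · simp [hp0]
      · have h1 : (1 : ℤ) ≤ (S.card : ℤ) := by exact_mod_cast hS.card_pos
        have h2 : (1 : ℤ) ≤ (S.card : ℤ) ^ 2 := by nlinarith
        have := mul_le_mul_of_nonneg_left h2 hh
        have := hp' S
        linarith
    have h1 : h * (S.card : ℤ) ^ 2 + p S ≤ 2 ^ b := by
      have h2 : (S.card : ℤ) ≤ n := by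
        exact_mod_cast (Finset.card_le_univ S).trans_eq (Fintype.card_fin n)
      have h3 : (S.card : ℤ) ^ 2 ≤ (n : ℤ) ^ 2 := by gcongr
      have := mul_le_mul_of_nonneg_left h3 hh
      have := hp' S
      linarith
    obtain ⟨k, hk⟩ := Int.eq_ofNat_of_zero_le h0
    refine ⟨k, ?_, ?_⟩
    · rw [hk] at h1; exact_mod_cast h1
    · simp only [hk]; simp

theorem isBestResponse_div {n : ℕ} (f c : SetFn n) {s : ℝ} (hs : 0 < s) (α : unitInterval)
    (S : Finset (Fin n)) :
    IsBestResponse (fun T => f T / s) (fun T => c T / s) α S ↔ IsBestResponse f c α S := by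
  have h : ∀ T, agentUtility (fun T => f T / s) (fun T => c T / s) α T
      = agentUtility f c α T / s := fun T => by simp only [agentUtility]; ring
  simp only [IsBestResponse, h, div_le_div_iff_of_pos_right hs, div_left_inj' hs.ne']

theorem isOptimalContract_div {n : ℕ} (f c : SetFn n) {s : ℝ} (hs : 0 < s) (α : unitInterval) :
    IsOptimalContract (fun T => f T / s) (fun T => c T / s) α ↔ IsOptimalContract f c α := by
  have h : ∀ (α : unitInterval) T, principalUtility (fun T => f T / s) α T
      = principalUtility f α T / s := fun α T => by simp only [principalUtility]; ring
  simp only [IsOptimalContract, isBestResponse_div f c hs, h, div_le_div_iff_of_pos_right hs]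

namespace Curve

variable (C : Curve) {n : ℕ} (R : Ranking n (2 * C.K))

/-- The perturbation of the reward. -/
def rewardPert (x : Fin C.K → Bool) (S : Finset (Fin n)) : ℤ :=
  if R.rank S < 2 * C.K then -(R.rank S * C.W) + 4 * bitVal x (R.rank S) else 0

/-- The perturbation of the cost. -/
def costPert (y : Fin C.K → Bool) (S : Finset (Fin n)) : ℤ :=
  if R.rank S < 2 * C.K then -(R.rank S * C.W) - C.diff (R.rank S) - 4 * bitVal y (R.rank S)
  else if R.rank S = 2 * C.K then 0 else 1

/-- The reward function, before scaling. -/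
def rewardFn (x : Fin C.K → Bool) : SetFn n := fun S =>
  ((C.h * S.card ^ 2 + C.rewardPert R x S : ℤ) : ℝ)

/-- The cost function, before scaling. -/
def costFn (y : Fin C.K → Bool) : SetFn n := fun S =>
  ((C.h * S.card ^ 2 + C.costPert R y S : ℤ) : ℝ)

theorem rewardPert_le (x : Fin C.K → Bool) (S : Finset (Fin n)) :
    2 * |C.rewardPert R x S| ≤ C.h := by
  have h1 := C.h_ge
  have h2 := C.W_ge
  rw [rewardPert]
  split_ifs with h
  · have h3 := C.mul_W_le h
    have h4 : 0 ≤ (R.rank S : ℤ) * C.W := mul_nonneg (by positivity) C.W_pos.le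
    have h5 : |-(R.rank S * C.W) + 4 * bitVal x (R.rank S)| ≤ R.rank S * C.W + 4 := by
      rw [abs_le]
      rcases bitVal_cases x (R.rank S) with e | e <;> rw [e] <;> constructor <;> linarith
    linarith
  · simp; linarith

theorem costPert_le (y : Fin C.K → Bool) (S : Finset (Fin n)) :
    2 * |C.costPert R y S| ≤ C.h := by
  have h1 := C.h_ge
  have h2 := C.W_ge
  rw [costPert]
  split_ifs with h
  · have h3 := C.mul_W_le h
    have h4 : 0 ≤ (R.rank S : ℤ) * C.W := mul_nonneg (by positivity) C.W_pos.le
    have h6 := C.diff_nonneg (R.rank S)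
    have h7 := C.diff_le (R.rank S)
    have h5 : |-(R.rank S * C.W) - C.diff (R.rank S) - 4 * bitVal y (R.rank S)|
        ≤ R.rank S * C.W + C.diff (R.rank S) + 4 := by
      rw [abs_le]
      rcases bitVal_cases y (R.rank S) with e | e <;> rw [e] <;> constructor <;> linarith
    linarith
  · simp; linarith
  · simp; linarith

theorem rewardPert_empty (x : Fin C.K → Bool) : C.rewardPert R x ∅ = 0 := by
  rw [rewardPert, R.rank_empty, if_neg (lt_irrefl _)]

theorem costPert_empty (y : Fin C.K → Bool) : C.costPert R y ∅ = 0 := by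
  rw [costPert, R.rank_empty, if_neg (lt_irrefl _), if_pos rfl]

variable (hF : C.F = C.h * R.m ^ 2)

include hF in
theorem rewardFn_eq (x : Fin C.K → Bool) (S : Finset (Fin n)) (hS : R.rank S ≤ 2 * C.K) :
    C.rewardFn R x S = C.rewardR x (R.rank S) := by
  rw [rewardFn, rewardR, Int.cast_inj]
  rcases hS.eq_or_lt with h | h
  · have : S = ∅ := R.rank_injective S ∅ (h.trans R.rank_empty.symm) hS
    rw [h, C.reward_of_le x le_rfl, this, rewardPert_empty]; simp
  · rw [rewardPert, if_pos h, R.card_eq S h, reward, C.phi_of_lt h, hF]; ring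

include hF in
theorem rewardFn_sub_costFn (x y : Fin C.K → Bool) (S : Finset (Fin n))
    (hS : R.rank S ≤ 2 * C.K) :
    C.rewardFn R x S - C.costFn R y S = C.surplus x y (R.rank S) := by
  rw [C.rewardFn_eq R hF x S hS, surplus, rewardR, sub_right_inj, costFn, Int.cast_inj]
  rcases hS.eq_or_lt with h | h
  · have : S = ∅ := R.rank_injective S ∅ (h.trans R.rank_empty.symm) hS
    rw [h, C.cost_of_le y le_rfl, this, costPert_empty]; simp
  · rw [costPert, if_pos h, R.card_eq S h, cost, C.phi_of_lt h, hF]; ring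

include hF in
theorem agentUtility_eq (x y : Fin C.K → Bool) (α : unitInterval) (S : Finset (Fin n))
    (hS : R.rank S ≤ 2 * C.K) :
    agentUtility (C.rewardFn R x) (C.costFn R y) α S
      = C.surplus x y (R.rank S) - (1 - (α : ℝ)) * C.rewardR x (R.rank S) := by
  rw [agentUtility, ← C.rewardFn_sub_costFn R hF x y S hS, ← C.rewardFn_eq R hF x S hS]; ring

/-- Unranked sets cost one more than their reward, so they lose to the empty set under every
contract. -/
theorem agentUtility_neg (x y : Fin C.K → Bool) (α : unitInterval) (S : Finset (Fin n))
    (hS : 2 * C.K < R.rank S) :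
    agentUtility (C.rewardFn R x) (C.costFn R y) α S < 0 := by
  have h1 : C.costFn R y S = C.rewardFn R x S + 1 := by
    rw [costFn, rewardFn, costPert, rewardPert, if_neg (by omega), if_neg (by omega),
      if_neg (by omega)]
    push_cast; ring
  have h2 : 0 ≤ C.rewardFn R x S := by
    rw [rewardFn, rewardPert, if_neg (by omega)]
    have h3 := C.W_pos
    have h4 := C.h_ge
    have h5 : 0 ≤ C.h := by linarith
    exact_mod_cast (by positivity : 0 ≤ C.h * (S.card : ℤ) ^ 2 + 0)
  have := α.2.1
  have := α.2.2
  rw [agentUtility, h1]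
  nlinarith

theorem line_eq_zero (x y : Fin C.K → Bool) (t : ℝ) :
    C.surplus x y (2 * C.K) - t * C.rewardR x (2 * C.K) = 0 := by
  simp [surplus, rewardR, C.reward_of_le x le_rfl, C.cost_of_le y le_rfl]

include hF in
/-- Best responses are determined by comparing consecutive lines. -/
theorem isBestResponse_iff (x y : Fin C.K → Bool) (α : unitInterval) (S : Finset (Fin n)) :
    IsBestResponse (C.rewardFn R x) (C.costFn R y) α S ↔ R.rank S ≤ 2 * C.K ∧
      (∀ j, j + 1 = R.rank S → C.surplus x y j - (1 - (α : ℝ)) * C.rewardR x j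
        < C.surplus x y (R.rank S) - (1 - (α : ℝ)) * C.rewardR x (R.rank S)) ∧
      (R.rank S < 2 * C.K →
        C.surplus x y (R.rank S + 1) - (1 - (α : ℝ)) * C.rewardR x (R.rank S + 1)
          ≤ C.surplus x y (R.rank S) - (1 - (α : ℝ)) * C.rewardR x (R.rank S)) := by
  constructor
  · rintro ⟨h1, h2⟩
    have hS : R.rank S ≤ 2 * C.K := by
      by_contra h
      have h3 := C.agentUtility_neg R x y α S (not_le.1 h)
      have h4 := h1 ∅
      rw [C.agentUtility_eq R hF x y α ∅ R.rank_empty.le, R.rank_empty, C.line_eq_zero] at h4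
      linarith
    refine ⟨hS, ?_, ?_⟩
    · intro j hj
      obtain ⟨T, hT⟩ := R.exists_rank_eq j (by omega)
      have h3 := h1 T
      have h4 := h2 T
      rw [C.agentUtility_eq R hF x y α T (by omega), C.agentUtility_eq R hF x y α S hS, hT] at h3 h4
      -- A tie with the line of smaller rank is impossible: that set has the larger reward and would
      -- win the tie. Hence strictness on this side only.
      refine lt_of_le_of_ne h3 fun h5 => ?_
      have h6 := h4 h5
      rw [C.rewardFn_eq R hF x T (by omega), C.rewardFn_eq R hF x S hS, hT] at h6
      exact absurd h6 (not_le.2 (C.rewardR_strictAnti x (by omega) hS))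
    · intro hlt
      obtain ⟨T, hT⟩ := R.exists_rank_eq (R.rank S + 1) (by omega)
      have h3 := h1 T
      rwa [C.agentUtility_eq R hF x y α T (by omega), C.agentUtility_eq R hF x y α S hS, hT] at h3
  · rintro ⟨hS, h1, h2⟩
    obtain ⟨h3, h4⟩ := envelope_of_neighbours (2 * C.K) (C.rewardR x) (C.surplus x y)
      (fun k hk => C.rewardR_lt x hk) (fun k hk => C.tau_lt_tau_succ x y hk) (1 - (α : ℝ))
      (R.rank S) h1 h2 hS
    have hother : ∀ T, 2 * C.K < R.rank T → agentUtility (C.rewardFn R x) (C.costFn R y) α T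
        < agentUtility (C.rewardFn R x) (C.costFn R y) α S := by
      intro T hT
      have h5 := C.agentUtility_neg R x y α T hT
      have h6 := h4 (2 * C.K) hS le_rfl
      rw [C.line_eq_zero] at h6
      rw [C.agentUtility_eq R hF x y α S hS]
      linarith
    constructor
    · intro T
      rcases lt_or_ge (2 * C.K) (R.rank T) with hT | hT
      · exact (hother T hT).le
      · rw [C.agentUtility_eq R hF x y α T hT, C.agentUtility_eq R hF x y α S hS]
        rcases lt_or_ge (R.rank T) (R.rank S) with h | h
        · exact (h3 _ h).le
        · exact h4 _ h hT
    · intro T hT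
      rcases lt_or_ge (2 * C.K) (R.rank T) with hT' | hT'
      · exact absurd hT (hother T hT').ne
      · rw [C.agentUtility_eq R hF x y α T hT', C.agentUtility_eq R hF x y α S hS] at hT
        rw [C.rewardFn_eq R hF x T hT', C.rewardFn_eq R hF x S hS]
        rcases lt_trichotomy (R.rank T) (R.rank S) with h | h | h
        · exact absurd hT (h3 _ h).ne
        · rw [h]
        · exact (C.rewardR_strictAnti x h hT').le

-- Tied best responses have equal reward, and rewards strictly decrease with rank. So the oracle's
-- choice rule plays no role on these instances.
include hF in
theorem isBestResponse_unique (x y : Fin C.K → Bool) (α : unitInterval) (S T : Finset (Fin n))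
    (hS : IsBestResponse (C.rewardFn R x) (C.costFn R y) α S)
    (hT : IsBestResponse (C.rewardFn R x) (C.costFn R y) α T) : S = T := by
  have h1 := ((C.isBestResponse_iff R hF x y α S).1 hS).1
  have h2 := ((C.isBestResponse_iff R hF x y α T).1 hT).1
  have hu := le_antisymm (hS.1 T) (hT.1 S)
  have hf := le_antisymm (hS.2 T hu) (hT.2 S hu.symm)
  rw [C.rewardFn_eq R hF x T h2, C.rewardFn_eq R hF x S h1] at hf
  refine R.rank_injective S T ?_ h1
  rcases lt_trichotomy (R.rank S) (R.rank T) with h | h | h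
  · exact absurd hf (C.rewardR_strictAnti x h h2).ne
  · exact h
  · exact absurd hf (C.rewardR_strictAnti x h h1).ne'

theorem le_tau_iff (x y : Fin C.K → Bool) {k : ℕ} (hk : k < 2 * C.K) (t : ℝ) :
    C.surplus x y (k + 1) - t * C.rewardR x (k + 1) ≤ C.surplus x y k - t * C.rewardR x k
      ↔ t ≤ C.tau x y k := by
  have := C.rewardR_lt x hk
  rw [tau, breakpoint, le_div_iff₀ (by linarith)]
  constructor <;> intro h <;> linarith

include hF in
/-- If the two sets meet only in `i`, the optimal contract is the `i`-th peak. -/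
theorem eq_peak_of_isOptimalContract (x y : Fin C.K → Bool) (i : Fin C.K) (hx : x i = true)
    (hy : y i = true) (hxy : ∀ j, j ≠ i → ¬ (x j = true ∧ y j = true)) (α : unitInterval)
    (hα : IsOptimalContract (C.rewardFn R x) (C.costFn R y) α) : 1 - (α : ℝ) = C.peak i := by
  obtain ⟨S, hS, hopt⟩ := hα
  have hk : 2 * (i : ℕ) + 1 < 2 * C.K := by omega
  obtain ⟨Z, hZ⟩ := R.exists_rank_eq (2 * (i : ℕ)) (by omega)
  have hmem := C.peak_mem i
  let β : unitInterval := ⟨1 - C.peak i, by constructor <;> linarith⟩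
  have hβ : (1 : ℝ) - β = C.peak i := by simp [β]
  -- The peak is the right end of the segment of Z, where Z ties with its successor and wins by its
  -- larger reward.
  have hZbr : IsBestResponse (C.rewardFn R x) (C.costFn R y) β Z := by
    rw [C.isBestResponse_iff R hF, hβ, hZ, ← C.tau_eq_peak x y i hx hy]
    refine ⟨by omega, ?_, fun h => (C.le_tau_iff x y h _).2 le_rfl⟩
    intro j hj
    by_contra hcon
    rw [← hj] at hcon
    have h1 := (C.le_tau_iff x y (by omega) _).1 (not_lt.1 hcon)
    exact absurd h1 (not_le.2 (C.tau_lt_tau_succ x y (by omega)))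
  have h1 := hopt β Z hZbr
  obtain ⟨hSr, -, hS2⟩ := (C.isBestResponse_iff R hF x y α S).1 hS
  rw [principalUtility, principalUtility, hβ, C.rewardFn_eq R hF x Z (by omega),
    C.rewardFn_eq R hF x S hSr, hZ] at h1
  have h2 := C.peak_mul_reward_gt x i hx
  have hb : (0 : ℝ) < C.U + 4 * C.F / C.W := by
    have h3 : (0 : ℝ) < C.U := by exact_mod_cast C.U_pos
    have h4 : (0 : ℝ) < C.F := by exact_mod_cast C.F_pos
    have h5 : (0 : ℝ) < C.W := by exact_mod_cast C.W_pos
    positivity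
  rcases hSr.eq_or_lt with hSr | hSr
  · rw [hSr] at h1
    have : C.rewardR x (2 * C.K) = 0 := by rw [rewardR, C.reward_of_le x le_rfl]; simp
    rw [this] at h1
    linarith
  have h3 := (C.le_tau_iff x y hSr _).1 (hS2 hSr)
  have hr0 : C.rewardR x (2 * C.K) = 0 := by rw [rewardR, C.reward_of_le x le_rfl]; simp
  have hpos : 0 < C.rewardR x (R.rank S) := by
    have := C.rewardR_strictAnti x hSr le_rfl
    rwa [hr0] at this
  by_cases hbits : bitVal x (R.rank S) = 1 ∧ bitVal y (R.rank S) = 1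
  · have hrank : R.rank S = 2 * (i : ℕ) := by
      have heven : R.rank S % 2 = 0 := by
        by_contra h
        have := bitVal_odd x (R.rank S) (by omega)
        omega
      let j : Fin C.K := ⟨R.rank S / 2, by omega⟩
      have hj : R.rank S = 2 * (j : ℕ) := by simp only [j]; omega
      rw [hj, bitVal_two_mul, bitVal_two_mul] at hbits
      have hj2 : x j = true ∧ y j = true := by
        constructor
        · by_contra h; simp [h] at hbits
        · by_contra h; simp [h] at hbits
      have : j = i := by
        by_contra h; exact hxy j h hj2
      rw [hj, this]
    rw [hrank] at h1 h3 hpos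
    rw [C.tau_eq_peak x y i hx hy] at h3
    -- Being a best response bounds 1 - α by the peak from above; optimality against β bounds it
    -- from below.
    exact le_antisymm h3 (le_of_mul_le_mul_right h1 hpos)
  · have h4 := C.tau_mul_reward_le x y hSr hbits
    have h5 := mul_le_mul_of_nonneg_right h3 hpos.le
    linarith

/-- The bits near an index. -/
def window (x : Fin C.K → Bool) (k : ℕ) : Bool × Bool × Bool :=
  (bitAt x (k - 1), bitAt x k, bitAt x (k + 1))

theorem bitVal_eq_of_window {x x' : Fin C.K → Bool} {k : ℕ} (h : C.window x k = C.window x' k) :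
    (∀ j, j + 1 = k → bitVal x j = bitVal x' j) ∧ bitVal x k = bitVal x' k ∧
      bitVal x (k + 1) = bitVal x' (k + 1) := by
  simp only [window, Prod.mk.injEq] at h
  refine ⟨?_, by simp only [bitVal, h.2.1], by simp only [bitVal, h.2.2]⟩
  rintro j rfl
  have := h.1
  rw [Nat.add_sub_cancel] at this
  simp only [bitVal, this]

-- The segment of a set ends at the crossings with its two neighbours, and these involve only the
-- bits at three consecutive ranks. This locality is what makes query answers cheap to record.
include hF in
theorem isBestResponse_congr {x x' y y' : Fin C.K → Bool} {S : Finset (Fin n)}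
    (hx : C.window x (R.rank S) = C.window x' (R.rank S))
    (hy : C.window y (R.rank S) = C.window y' (R.rank S)) (α : unitInterval)
    (h : IsBestResponse (C.rewardFn R x) (C.costFn R y) α S) :
    IsBestResponse (C.rewardFn R x') (C.costFn R y') α S := by
  rw [C.isBestResponse_iff R hF] at h ⊢
  obtain ⟨a1, a2, a3⟩ := C.bitVal_eq_of_window hx
  obtain ⟨b1, b2, b3⟩ := C.bitVal_eq_of_window hy
  obtain ⟨h1, h2, h3⟩ := h
  refine ⟨h1, ?_, ?_⟩
  · intro j hj
    have := h2 j hj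
    simpa only [surplus, rewardR, reward, cost, a1 j hj, b1 j hj, a2, b2] using this
  · intro hlt
    have := h3 hlt
    simpa only [surplus, rewardR, reward, cost, a2, b2, a3, b3] using this

open Classical in
/-- The hard instances. -/
noncomputable def hardFamily {b : ℕ} (br : Oracle n) (hbr : br.Valid)
    (hF : C.F = C.h * R.m ^ 2) (hb : 2 * (C.h * n ^ 2) + C.h ≤ 2 * 2 ^ b) :
    HardFamily n b br (Fin C.K)
      (Finset (Fin n) × (Bool × Bool × Bool) × (Bool × Bool × Bool)) where
  f x := fun S => C.rewardFn R x S / 2 ^ b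
  c y := fun S => C.costFn R y S / 2 ^ b
  admissible_f x := isAdmissible_of_perturbation C.h (C.rewardPert R x) (C.rewardPert_le R x)
    (C.rewardPert_empty R x) hb
  admissible_c y := isAdmissible_of_perturbation C.h (C.costPert R y) (C.costPert_le R y)
    (C.costPert_empty R y) hb
  ev x y S := (S, C.window x (R.rank S), C.window y (R.rank S))
  ev_injective x y x' y' S S' h := (Prod.mk.inj h).1
  ev_local x y x' y' S h := by
    simp only [Prod.mk.injEq, true_and] at h
    have hbr' : ∀ (x y : Fin C.K → Bool) (α : unitInterval),
        br (fun S => C.rewardFn R x S / 2 ^ b) (fun S => C.costFn R y S / 2 ^ b) α = S ↔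
          IsBestResponse (C.rewardFn R x) (C.costFn R y) α S := by
      intro x y α
      have h1 := (isBestResponse_div (C.rewardFn R x) (C.costFn R y)
        (show (0 : ℝ) < 2 ^ b by positivity) α _).1 (hbr _ _ α)
      exact ⟨fun h => h ▸ h1, fun h => C.isBestResponse_unique R hF x y α _ _ h1 h⟩
    refine ⟨by rw [h.2], fun α => ?_⟩
    simp only [hbr']
    exact ⟨C.isBestResponse_congr R hF rfl h.2 α, C.isBestResponse_congr R hF h.1.symm rfl α⟩
  label α := if h : ∃ i : Fin C.K, 1 - (α : ℝ) = C.peak i then some h.choose else none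
  label_eq i x y hx hy hxy α hα := by
    rw [isOptimalContract_div _ _ (by positivity)] at hα
    have h1 := C.eq_peak_of_isOptimalContract R hF x y i hx hy hxy α hα
    have h2 : ∃ i : Fin C.K, 1 - (α : ℝ) = C.peak i := ⟨i, h1⟩
    rw [dif_pos h2, C.peak_injective (h2.choose_spec.symm.trans h1)]

end Curve

/-! ### Binomial estimates, choice of parameters and the final bound. -/

/-- By induction from (m + 1) * centralBinom (m + 1) = 2 * (2m + 1) * centralBinom m, since 4m(m +
1) ≤ (2m + 1)^2. -/
theorem sixteen_pow_le_centralBinom_sq (m : ℕ) (hm : 1 ≤ m) :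
    16 ^ m ≤ 4 * m * m.centralBinom ^ 2 := by
  induction m, hm using Nat.le_induction with
  | base => simp [Nat.centralBinom]
  | succ m hm ih =>
    have h := Nat.succ_mul_centralBinom_succ m
    have h1 : (m + 1) * (4 * (m + 1) * (m + 1).centralBinom ^ 2)
        = 16 * (2 * m + 1) ^ 2 * m.centralBinom ^ 2 := by
      calc _ = 4 * ((m + 1) * (m + 1).centralBinom) ^ 2 := by ring
        _ = _ := by rw [h]; ring
    have h2 : (m + 1) * 16 ^ (m + 1) ≤ (m + 1) * (4 * (m + 1) * (m + 1).centralBinom ^ 2) := by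
      rw [h1]
      calc (m + 1) * 16 ^ (m + 1) = 16 * (m + 1) * 16 ^ m := by ring
        _ ≤ 16 * (m + 1) * (4 * m * m.centralBinom ^ 2) := Nat.mul_le_mul_left _ ih
        _ = 16 * (4 * m * (m + 1)) * m.centralBinom ^ 2 := by ring
        _ ≤ 16 * (2 * m + 1) ^ 2 * m.centralBinom ^ 2 := by gcongr; nlinarith
    exact Nat.le_of_mul_le_mul_left h2 (by omega)

theorem four_pow_le_choose_half_sq (n : ℕ) (hn : 1 ≤ n) :
    4 ^ n ≤ 4 * n * n.choose (n / 2) ^ 2 := by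
  obtain ⟨m, rfl | rfl⟩ := Nat.even_or_odd' n
  · have h := sixteen_pow_le_centralBinom_sq m (by omega)
    rw [Nat.mul_div_cancel_left m (by norm_num), pow_mul]
    rw [Nat.centralBinom] at h
    calc (4 ^ 2) ^ m = 16 ^ m := by norm_num
      _ ≤ 4 * m * (2 * m).choose m ^ 2 := h
      _ ≤ _ := by gcongr; omega
  · have h := sixteen_pow_le_centralBinom_sq (m + 1) (by omega)
    have h1 : (m + 1).centralBinom = 2 * (2 * m + 1).choose m := by
      rw [Nat.centralBinom, show 2 * (m + 1) = 2 * m + 1 + 1 by ring, Nat.choose_succ_succ,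
        Nat.choose_symm_half]
      ring
    rw [h1] at h
    rw [show (2 * m + 1) / 2 = m by omega]
    have h2 : 4 ^ (2 * m + 1) = 4 * 16 ^ m := by
      rw [pow_succ, pow_mul]; norm_num [mul_comm]
    rw [h2]
    have h3 : 16 * 16 ^ m ≤ 16 * ((m + 1) * (2 * m + 1).choose m ^ 2) := by
      rw [← pow_succ']
      calc _ ≤ _ := h
        _ = _ := by ring
    have h4 := Nat.le_of_mul_le_mul_left h3 (by norm_num)
    calc 4 * 16 ^ m ≤ 4 * ((m + 1) * (2 * m + 1).choose m ^ 2) := Nat.mul_le_mul_left _ h4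
      _ = 4 * (m + 1) * (2 * m + 1).choose m ^ 2 := by ring
      _ ≤ _ := by gcongr; omega

theorem two_pow_div_sqrt_le_choose_half (n : ℕ) (hn : 1 ≤ n) :
    (2 : ℝ) ^ n / Real.sqrt n ≤ 2 * n.choose (n / 2) := by
  have hn' : (0 : ℝ) < n := by exact_mod_cast hn
  have hs := Real.sqrt_pos.2 hn'
  rw [div_le_iff₀ hs]
  have h : (4 : ℝ) ^ n ≤ 4 * n * n.choose (n / 2) ^ 2 := by
    exact_mod_cast four_pow_le_choose_half_sq n hn
  refine le_of_sq_le_sq ?_ (by positivity)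
  rw [mul_pow, Real.sq_sqrt hn'.le, ← pow_mul, mul_comm n 2, pow_mul]
  calc ((2 : ℝ) ^ 2) ^ n = 4 ^ n := by norm_num
    _ ≤ _ := h
    _ = _ := by ring

theorem tendsto_polynomial_div_two_pow (r : Polynomial ℕ) :
    Filter.Tendsto (fun n : ℕ => ((r.eval n : ℕ) : ℝ) / 2 ^ n) Filter.atTop (nhds 0) := by
  induction r using Polynomial.induction_on' with
  | add p q hp hq =>
    have := hp.add hq
    simpa [Polynomial.eval_add, add_div] using this
  | monomial k a =>
    have := (tendsto_pow_const_div_const_pow_of_one_lt k (one_lt_two (α := ℝ))).const_mul (a : ℝ)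
    simpa [Polynomial.eval_monomial, mul_div_assoc] using this

theorem exists_polynomial_le_two_pow (r : Polynomial ℕ) :
    ∃ N : ℕ, ∀ n ≥ N, r.eval n ≤ 2 ^ n := by
  have h := (tendsto_polynomial_div_two_pow r).eventually_le_const (one_pos (α := ℝ))
  obtain ⟨N, hN⟩ := Filter.eventually_atTop.1 h
  refine ⟨N, fun n hn => ?_⟩
  have := hN n hn
  rw [div_le_one (by positivity)] at this
  exact_mod_cast this

/-- The parameters for `n` actions. -/
theorem exists_curve (n m K : ℕ) (hm : 1 ≤ m) (hmn : m ≤ n) (hK : 1 ≤ K) (hKn : 2 * K ≤ 2 ^ n) :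
    ∃ C : Curve, C.K = K ∧ C.F = C.h * m ^ 2 ∧
      2 * (C.h * n ^ 2) + C.h ≤ 2 * 2 ^ (8 * n + 16) := by
  have hn2 : (n : ℤ) ≤ 2 ^ n := by exact_mod_cast Nat.lt_two_pow_self.le
  have hm1 : (1 : ℤ) ≤ m := by exact_mod_cast hm
  have hm2 : (m : ℤ) ≤ 2 ^ n := le_trans (by exact_mod_cast hmn) hn2
  have hK' : (2 * K : ℤ) ≤ 2 ^ n := by exact_mod_cast hKn
  obtain ⟨X, hX⟩ : ∃ X : ℤ, X = 2 ^ n := ⟨_, rfl⟩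
  have hX1 : 1 ≤ X := by rw [hX]; exact one_le_pow₀ (by norm_num)
  rw [← hX] at hn2 hm2 hK'
  have hsq : (1 : ℤ) ≤ (m : ℤ) ^ 2 := one_le_pow₀ hm1
  -- With 2K ≤ X = 2^n and m ≤ X, these powers meet `W_le`, make `U_le` an equality, and leave 18 ≤
  -- 2^5 for `U_ge`. All values are O(X^8), which accounts for the precision 8n + 16.
  refine ⟨⟨K, 2 ^ 15 * X ^ 6 * m ^ 2, 2 ^ 12 * X ^ 5, 2 ^ 11 * X ^ 6, 2 ^ 15 * X ^ 6, hK, ?_, ?_, ?_,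
    ?_, ?_⟩, rfl, rfl, ?_⟩
  · have : 1 ≤ X ^ 5 := one_le_pow₀ hX1
    linarith
  · calc 16 * (K : ℤ) * (2 ^ 12 * X ^ 5) = 2 ^ 15 * X ^ 5 * (2 * K) := by ring
      _ ≤ 2 ^ 15 * X ^ 5 * X := by gcongr
      _ = _ := by ring
  · exact le_mul_of_one_le_right (by positivity) hsq
  · exact le_of_eq (by ring)
  · calc 18 * (2 ^ 15 * X ^ 6 * (m : ℤ) ^ 2) ^ 2 = 18 * 2 ^ 30 * X ^ 12 * (m : ℤ) ^ 4 := by ring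
      _ ≤ 18 * 2 ^ 30 * X ^ 12 * X ^ 4 := by gcongr
      _ ≤ 2 ^ 35 * X ^ 12 * X ^ 4 := by gcongr; norm_num
      _ = _ := by ring
  · have e : (2 : ℤ) ^ (8 * n + 16) = 2 ^ 16 * X ^ 8 := by rw [hX]; ring
    rw [e]
    have h2 : (n : ℤ) ^ 2 ≤ X ^ 2 := by gcongr
    have h3 : 1 ≤ X ^ 2 := one_le_pow₀ hX1
    have h4 : (0 : ℤ) ≤ 2 ^ 15 * X ^ 6 := by positivity
    have h5 := mul_le_mul_of_nonneg_left h2 h4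
    have h6 := mul_le_mul_of_nonneg_left h3 h4
    have h7 : 0 ≤ X ^ 8 := by positivity
    calc 2 * (2 ^ 15 * X ^ 6 * (n : ℤ) ^ 2) + 2 ^ 15 * X ^ 6
        ≤ 2 * (2 ^ 15 * X ^ 6 * X ^ 2) + 2 ^ 15 * X ^ 6 * X ^ 2 := by linarith
      _ = 3 * 2 ^ 15 * X ^ 8 := by ring
      _ ≤ _ := by linarith

theorem log_two_pow_le (k : ℕ) : Real.log (2 ^ k) ≤ k := by
  rw [Real.log_pow]
  exact mul_le_of_le_one_right (by positivity) (by linarith [Real.log_two_lt_d9])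

theorem mainTheorem4 :
    ∃ (b : Polynomial ℕ) (C : ℝ), 0 < C ∧
      ∀ q : Polynomial ℕ, ∃ N : ℕ, ∀ n : ℕ, N ≤ n →
        ∀ br : Oracle n, br.Valid →
        ∀ (Ω : Type*) [MeasurableSpace Ω] (μ : Measure Ω) [IsProbabilityMeasure μ]
          (P : Ω → Protocol n),
          ComputesOptimalContract (b.eval n) br μ P →
          QueriesAtMost (b.eval n) br μ P (q.eval n) →
          ∀ B : ℕ, BitsAtMost (b.eval n) br μ P B →
            C * (2 ^ n / Real.sqrt n) ≤ B := by
  -- With Z = 2^n / sqrt n, the bound K ≥ Z/8 gives 11Z/216 ≤ 1568B + Z/44 once the terms not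
  -- involving B are at most Z/44. This yields B ≥ Z/60000.
  refine ⟨8 * Polynomial.X + 16, 1 / 60000, by norm_num, fun q => ?_⟩
  obtain ⟨N, hN⟩ := exists_polynomial_le_two_pow
    (44 * Polynomial.X * (4 + 784 * (2 + q * (Polynomial.X + 8) + Polynomial.X)))
  refine ⟨N + 2, fun n hn br hbr Ω _ μ _ P hP hq B hB => ?_⟩
  have hb : Polynomial.eval n (8 * Polynomial.X + 16 : Polynomial ℕ) = 8 * n + 16 := by
    simp
  rw [hb] at hP hq hB
  have hpoly := hN n (by omega)
  simp only [Polynomial.eval_mul, Polynomial.eval_add, Polynomial.eval_X,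
    Polynomial.eval_ofNat] at hpoly
  set Q := q.eval n with hQ
  set c := n.choose (n / 2) with hc
  have hlow := two_pow_div_sqrt_le_choose_half n (by omega)
  have hc2 : 2 ≤ c := by
    calc 2 ≤ n := by omega
      _ = n.choose 1 := (Nat.choose_one_right n).symm
      _ ≤ c := Nat.choose_le_middle 1 n
  have hcn : c ≤ 2 ^ n := Nat.choose_le_two_pow _ _
  -- Two ranks per coordinate, one with bits and one without, so the middle layer of c sets provides
  -- c / 2 coordinates.
  obtain ⟨C, hCK, hCF, hCb⟩ := exists_curve n (n / 2) (c / 2) (by omega) (by omega) (by omega)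
    (by omega)
  obtain ⟨R, hR⟩ := exists_ranking n (n / 2) (2 * C.K) (by omega) (by omega) (by omega)
  have main := (C.hardFamily R br hbr (by rw [hR]; exact hCF) hCb).card_le μ P hP Q B hq hB
  rw [Fintype.card_fin] at main
  have hcard : Fintype.card (Finset (Fin n) × (Bool × Bool × Bool) × (Bool × Bool × Bool))
      = 2 ^ (n + 6) := by
    simp [pow_add]
  rw [hcard] at main
  have hlog : Real.log ((4 * 4 ^ B * (4 * 2 ^ (n + 6)) ^ Q * (C.K + 1) : ℕ) : ℝ)
      ≤ 2 + 2 * B + Q * (n + 8) + n := by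
    have h1 : 4 * 4 ^ B * (4 * 2 ^ (n + 6)) ^ Q * (C.K + 1)
        ≤ 2 ^ (2 + 2 * B + (n + 8) * Q + n) := by
      calc _ ≤ 4 * 4 ^ B * (4 * 2 ^ (n + 6)) ^ Q * 2 ^ n := Nat.mul_le_mul_left _ (by omega)
        _ = _ := by
          have e1 : 4 * 2 ^ (n + 6) = 2 ^ (n + 8) := by ring
          have e2 : 4 * 4 ^ B = 2 ^ (2 + 2 * B) := by rw [pow_add, pow_mul]; norm_num
          rw [e1, e2, ← pow_mul, ← pow_add, ← pow_add]
    have h2 : ((4 * 4 ^ B * (4 * 2 ^ (n + 6)) ^ Q * (C.K + 1) : ℕ) : ℝ)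
        ≤ 2 ^ (2 + 2 * B + (n + 8) * Q + n) := by exact_mod_cast h1
    have h3 := (Real.log_le_log (by positivity) h2).trans (log_two_pow_le _)
    push_cast at h3 ⊢
    linarith
  have hKr : (c : ℝ) ≤ 4 * C.K := by
    have : c ≤ 4 * C.K := by omega
    exact_mod_cast this
  have hn0 : (0 : ℝ) < n := by exact_mod_cast (by omega : 0 < n)
  have hs := Real.sqrt_pos.2 hn0
  have hsn : Real.sqrt n ≤ n := by
    rw [Real.sqrt_le_left hn0.le]
    have : (1 : ℝ) ≤ n := by exact_mod_cast (by omega : 1 ≤ n)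
    nlinarith
  have hpoly' : 44 * (4 + 784 * (2 + Q * ((n : ℝ) + 8) + n)) ≤ 2 ^ n / Real.sqrt n := by
    rw [le_div_iff₀ hs]
    have h1 : 44 * (n : ℝ) * (4 + 784 * (2 + Q * (n + 8) + n)) ≤ 2 ^ n := by exact_mod_cast hpoly
    refine le_trans ?_ h1
    calc 44 * (4 + 784 * (2 + Q * ((n : ℝ) + 8) + n)) * Real.sqrt n
        ≤ 44 * (4 + 784 * (2 + Q * ((n : ℝ) + 8) + n)) * n := by gcongr
      _ = _ := by ring
  generalize (2 : ℝ) ^ n / Real.sqrt n = Z at *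
  linarith
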